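/- Fix a countably infinite set $\mathcal V$ of variables. Signatures, term rewrite systems (TRSs) and substitution domains are finite; for each rule $\ell\to r$ of a TRS, $\ell$ is not a variable and every variable of $r$ occurs in $\ell$. A context $C$ is a term with exactly one hole $\Box$, and $C|_p=\Box$ says that the hole is at position $p$. A position $q$ is left of $q'$ iff $q=o\,i\,r$ and $q'=o\,j\,r'$ with $i<j$; it is above $q'$ (and $q'$ is below $q$) iff $q$ is a proper prefix of $q'$. For a TRS $\mathcal R$, write $t\to_q s$ if $t=D[\ell\sigma]$ and $s=D[r\sigma]$ for some rule $\ell\to r$ of $\mathcal R$, substitution $\sigma$ and context $D$ with $D|_q=\Box$; instances $\ell\sigma$ of left-hand sides are redexes. The step $t\to_q s$ is leftmost / innermost / outermost iff $t|_{q'}$ is not a redex for any position $q'$ of $t$ that is left of $q$ / below $q$ / above $q$. It is leftmost-innermost (leftmost-outermost) iff it is both leftmost and innermost (outermost). For a context $C$ and a substitution $\mu$ put $t(C,\mu)^0=t$, $t(C,\mu)^{n+1}=C[t(C,\mu)^n\mu]$, and $t(C,\mu)=t(C,\mu)^1=C[t\mu]$. A loop is a derivation $t_1\to_{q_1}t_2\to_{q_2}\cdots\to_{q_m}t_{m+1}=t_1(C,\mu)$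 with $m\ge 1$. With $C|_p=\Box$, it is a leftmost-innermost (leftmost-outermost) loop iff for all $n\in\mathbb N$ and all $1\le i\le m$ the step $t_i(C,\mu)^n\to_{p^nq_i}t_{i+1}(C,\mu)^n$ is leftmost-innermost (leftmost-outermost). **Corollary (Leftmost-innermost and leftmost-outermost loops are decidable).** Given a TRS $\mathcal R$ and a loop $t_1\to_{q_1}t_2\to_{q_2}\cdots\to_{q_m}t_{m+1}=t_1(C,\mu)$ of $\mathcal R$, the following two questions are decidable: (1) Is the loop a leftmost-innermost loop? (2) Is the loop a leftmost-outermost loop? That is, for each question there is one algorithm that takes the signature, $\mathcal R$, the terms and positions of the loop, $C$ and $\mu$ as input and answers the question correctly on every loop. -/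

import Mathlib

namespace LoopStrategies

/-! ### Terms, positions, substitutions -/

/-- First-order terms over the countably infinite set `ℕ` of variables. Function symbols are
named by natural numbers; a finite signature (below) says which names are symbols and fixes
their arities. -/
inductive Term : Type
  | var (x : ℕ) : Term
  | app (f : ℕ) (ts : List Term) : Term

namespace Term

/-- `t.subst σ` is the instance `tσ`. -/
def subst (σ : ℕ → Term) : Term → Term
  | var x => σ x
  | app f ts => app f (ts.map fun t => t.subst σ)

/-- `t.HasVar x`: the variable `x` occurs in `t`. -/
inductive HasVar (x : ℕ) : Term → Prop
  | var : HasVar x (var x)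
  | app {f : ℕ} {ts : List Term} {t : Term} (ht : t ∈ ts) (h : HasVar x t) : HasVar x (app f ts)

/-- `t.subtermAt p` is the subterm `t|_p`; it is `none` if `p` is not a position of `t`.
Positions are lists of argument indices, and arguments are numbered from `0`. -/
def subtermAt (t : Term) : List ℕ → Option Term
  | [] => some t
  | i :: p =>
    match t with
    | var _ => none
    | app _ ts =>
      match ts[i]? with
      | none => none
      | some u => u.subtermAt p

/-- A finite signature, as the list of arities of its symbols `0, 1, …, length - 1`. -/
abbrev Signature := List ℕ

/-- `WF sig t`: `t` is a term over the signature `sig`. -/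
inductive WF (sig : Signature) : Term → Prop
  | var (x : ℕ) : WF sig (var x)
  | app {f : ℕ} {ts : List Term} (hf : sig[f]? = some ts.length) (h : ∀ t ∈ ts, WF sig t) :
      WF sig (app f ts)

/-! Terms as inputs of algorithms: `x` is coded by `2 * x` and `f(t₁, …, tₖ)` by
`2 * ⟨f, ⟨t₁, …, tₖ⟩⟩ + 1`, with the standard codings of pairs and of lists of numbers. -/

/-- The code of a term. -/
def code : Term → ℕ
  | var x => 2 * x
  | app f ts => 2 * Nat.pair f (Encodable.encode (ts.map fun t => t.code)) + 1

theorem code_injective : ∀ s t : Term, s.code = t.code → s = t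
  | var x, var y, h => by
      simp only [code] at h
      congr 1
      omega
  | var x, app g us, h => by
      simp only [code] at h
      omega
  | app f ts, var y, h => by
      simp only [code] at h
      omega
  | app f ts, app g us, h => by
      simp only [code] at h
      have h1 : Nat.pair f (Encodable.encode (ts.map fun t => t.code)) =
          Nat.pair g (Encodable.encode (us.map fun t => t.code)) := by omega
      rw [Nat.pair_eq_pair] at h1
      obtain ⟨rfl, h2⟩ := h1
      have h3 := Encodable.encode_injective h2
      have key : ∀ (as bs : List Term), (∀ a ∈ as, a ∈ ts) →
          (as.map fun t => t.code) = (bs.map fun t => t.code) → as = bs := by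
        intro as
        induction as with
        | nil =>
          intro bs _ hb
          cases bs with
          | nil => rfl
          | cons b bs => simp at hb
        | cons a as ih =>
          intro bs ha hb
          cases bs with
          | nil => simp at hb
          | cons b bs =>
            simp only [List.map_cons, List.cons.injEq] at hb
            have hmem : a ∈ ts := ha a (by simp)
            rw [code_injective a b hb.1, ih bs (fun c hc => ha c (by simp [hc])) hb.2]
      rw [key ts us (fun a ha => ha) h3]
termination_by s => s
decreasing_by
  have := List.sizeOf_lt_of_mem hmem
  simp only [Term.app.sizeOf_spec]
  omega

theorem le_encode_of_mem : ∀ (l : List ℕ) (a : ℕ), a ∈ l → a ≤ Encodable.encode l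
  | b :: l, a, h => by
      rw [Encodable.encode_list_cons, Encodable.encode_nat]
      rcases List.mem_cons.1 h with rfl | h
      · exact (Nat.left_le_pair _ _).trans (Nat.le_succ _)
      · exact (le_encode_of_mem l a h).trans ((Nat.right_le_pair _ _).trans (Nat.le_succ _))

theorem code_surjective (n : ℕ) : ∃ t : Term, t.code = n := by
  induction n using Nat.strong_induction_on with
  | _ n ih =>
    rcases Nat.even_or_odd' n with ⟨k, rfl | rfl⟩
    · exact ⟨var k, by simp [code]⟩
    · set l : List ℕ := Denumerable.ofNat (List ℕ) k.unpair.2 with hl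
      have hle : Encodable.encode l ≤ k := by
        rw [hl, Denumerable.encode_ofNat]
        exact Nat.unpair_right_le k
      have key : ∀ m : List ℕ, (∀ a ∈ m, a ∈ l) → ∃ ts : List Term,
          (ts.map fun t => t.code) = m := by
        intro m
        induction m with
        | nil => exact fun _ => ⟨[], rfl⟩
        | cons a m ihm =>
          intro hm
          obtain ⟨ts, hts⟩ := ihm fun b hb => hm b (by simp [hb])
          have ha := le_encode_of_mem l a (hm a (by simp))
          obtain ⟨t, ht⟩ := ih a (by omega)
          exact ⟨t :: ts, by simp [ht, hts]⟩
      obtain ⟨ts, hts⟩ := key l fun a ha => ha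
      refine ⟨app k.unpair.1 ts, ?_⟩
      simp only [code]
      rw [hts, hl, Denumerable.encode_ofNat, Nat.pair_unpair]

/-- `code` as a bijection between terms and natural numbers. -/
noncomputable def codeEquiv : Term ≃ ℕ :=
  Equiv.ofBijective code ⟨fun s t h => code_injective s t h, code_surjective⟩

noncomputable instance : Denumerable Term := Denumerable.mk' codeEquiv

end Term

/-- `p` is left of `q`: `p = o i p'` and `q = o j q'` with `i < j`. -/
def LeftOf (p q : List ℕ) : Prop :=
  ∃ (o p' q' : List ℕ) (i j : ℕ), p = o ++ i :: p' ∧ q = o ++ j :: q' ∧ i < j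

/-- `p` is strictly above `q`: `p` is a proper prefix of `q`. -/
def StrictlyAbove (p q : List ℕ) : Prop :=
  p <+: q ∧ p ≠ q

/-- `p ^ n`, the `n`-fold concatenation of the position `p`. -/
def posPow (p : List ℕ) (n : ℕ) : List ℕ :=
  (List.replicate n p).flatten

/-- A substitution `{x₁ / s₁, …, xₖ / sₖ}` of finite domain, given as the list of its bindings
(the first binding of a variable counts; unbound variables are left unchanged). -/
abbrev FinSubst := List (ℕ × Term)

/-- The map on variables that a list of bindings describes. -/
def FinSubst.toFun (μ : FinSubst) (x : ℕ) : Term :=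
  (List.lookup x μ).getD (Term.var x)

/-- A context: a term with exactly one hole. It is given by its nodes on the path from the root
to the hole; the node `(f, l, r)` stands for `f(l₁, …, lₐ, _, r₁, …, r_b)`, where the rest of
the context goes to the place `_`. The hole alone is `[]`. -/
abbrev Ctx := List (ℕ × List Term × List Term)

namespace Ctx

/-- `C.fill t` is `C[t]`. -/
def fill : Ctx → Term → Term
  | [], t => t
  | (f, l, r) :: C, t => Term.app f (l ++ fill C t :: r)

/-- The position `p` of the hole, `C|_p = □`. -/
def holePos (C : Ctx) : List ℕ :=
  C.map fun c => c.2.1.length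

/-- `C` is a context over the signature. -/
def WF (sig : Term.Signature) (C : Ctx) : Prop :=
  ∀ c ∈ C, sig[c.1]? = some (c.2.1.length + 1 + c.2.2.length) ∧
    (∀ t ∈ c.2.1, Term.WF sig t) ∧ ∀ t ∈ c.2.2, Term.WF sig t

end Ctx

/-- The `n`-fold application `t(C,μ)ⁿ`: `t(C,μ)⁰ = t`, `t(C,μ)ⁿ⁺¹ = C[t(C,μ)ⁿμ]`. -/
def ctxSubstIter (C : Ctx) (μ : FinSubst) (t : Term) : ℕ → Term
  | 0 => t
  | n + 1 => C.fill ((ctxSubstIter C μ t n).subst μ.toFun)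

/-! ### Rewriting and strategies -/

/-- A finite list of rules `(ℓ, r)`, read as `ℓ → r`. -/
abbrev TRS := List (Term × Term)

/-- `R` is a term rewrite system over `sig`: for each rule `ℓ → r`, both sides are terms over
`sig`, `ℓ` is not a variable, and every variable of `r` occurs in `ℓ`. -/
def TRS.WF (sig : Term.Signature) (R : TRS) : Prop :=
  ∀ ρ ∈ R, Term.WF sig ρ.1 ∧ Term.WF sig ρ.2 ∧ (∀ x, ρ.1 ≠ Term.var x) ∧
    ∀ x, ρ.2.HasVar x → ρ.1.HasVar x

/-- `t →_p s`: `t = C[ℓσ]` and `s = C[rσ]` for a rule `ℓ → r`, a substitution `σ` and a context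
`C` whose hole is at `p`. -/
def Rewrites (R : TRS) (t : Term) (p : List ℕ) (s : Term) : Prop :=
  ∃ ρ ∈ R, ∃ (σ : ℕ → Term) (C : Ctx), C.holePos = p ∧
    t = C.fill (ρ.1.subst σ) ∧ s = C.fill (ρ.2.subst σ)

/-- `p` is a position of `t` and `t|_p` is a redex, i.e. an instance of a left-hand side. -/
def IsRedexAt (R : TRS) (t : Term) (p : List ℕ) : Prop :=
  ∃ ρ ∈ R, ∃ σ : ℕ → Term, t.subtermAt p = some (ρ.1.subst σ)

/-- A strategy assigns to a TRS `R` a relation `t →_p s`, a restriction of rewriting with `R`. -/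
abbrev Strategy := TRS → Term → List ℕ → Term → Prop

/-- Leftmost steps: no redex is at a position left of `p`. -/
def leftmost : Strategy := fun R t p s =>
  Rewrites R t p s ∧ ∀ q, LeftOf q p → ¬ IsRedexAt R t q

/-- Innermost steps: no redex is strictly below `p`. -/
def innermost : Strategy := fun R t p s =>
  Rewrites R t p s ∧ ∀ q, StrictlyAbove p q → ¬ IsRedexAt R t q

/-- Outermost steps: no redex is strictly above `p`. -/
def outermost : Strategy := fun R t p s =>
  Rewrites R t p s ∧ ∀ q, StrictlyAbove q p → ¬ IsRedexAt R t q

/-- Leftmost-innermost steps: both leftmost and innermost. -/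
def leftmostInnermost : Strategy := fun R t p s => leftmost R t p s ∧ innermost R t p s

/-- Leftmost-outermost steps: both leftmost and outermost. -/
def leftmostOutermost : Strategy := fun R t p s => leftmost R t p s ∧ outermost R t p s

/-! ### Loops -/

/-- `IsDerivation rel t [(q₁, t₂), …, (qₘ, tₘ₊₁)] u`: with `t₁ = t`, the relation `rel tᵢ qᵢ tᵢ₊₁`
holds for all `i ≤ m`, and `tₘ₊₁ = u`. -/
def IsDerivation (rel : Term → List ℕ → Term → Prop) :
    Term → List (List ℕ × Term) → Term → Prop
  | t, [], u => t = u
  | t, (q, s) :: rest, u => rel t q s ∧ IsDerivation rel s rest u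

/-- The finite data of a (candidate) loop `t₁ →_{q₁} t₂ →_{q₂} ⋯ →_{qₘ} tₘ₊₁ = t₁(C,μ)`. -/
structure LoopData where
  /-- the signature -/
  sig : Term.Signature
  /-- the term rewrite system -/
  rules : TRS
  /-- the term `t₁` -/
  start : Term
  /-- the steps `(q₁, t₂), …, (qₘ, tₘ₊₁)` -/
  steps : List (List ℕ × Term)
  /-- the context `C` -/
  ctx : Ctx
  /-- the substitution `μ` -/
  sub : FinSubst

namespace LoopData

/-- A loop datum is the tuple of its components. -/
def equivProd :
    LoopData ≃ Term.Signature × TRS × Term × List (List ℕ × Term) × Ctx × FinSubst where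
  toFun L := (L.sig, L.rules, L.start, L.steps, L.ctx, L.sub)
  invFun a := ⟨a.1, a.2.1, a.2.2.1, a.2.2.2.1, a.2.2.2.2.1, a.2.2.2.2.2⟩
  left_inv _ := rfl
  right_inv _ := rfl

/-- Loop data as inputs of algorithms, coded as tuples. -/
noncomputable instance : Primcodable LoopData := Primcodable.ofEquiv _ equivProd

/-- `L` is a loop `t₁ →_{q₁} ⋯ →_{qₘ} tₘ₊₁ = t₁(C,μ) = C[t₁μ]`, `m ≥ 1`, of a finite TRS over a
finite signature, all of whose terms are over that signature. -/
structure IsLoop (L : LoopData) : Prop where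
  wf_rules : L.rules.WF L.sig
  wf_start : Term.WF L.sig L.start
  wf_steps : ∀ a ∈ L.steps, Term.WF L.sig a.2
  wf_ctx : L.ctx.WF L.sig
  wf_sub : ∀ a ∈ L.sub, Term.WF L.sig a.2
  nonempty : L.steps ≠ []
  derivation : IsDerivation (Rewrites L.rules) L.start L.steps
    (ctxSubstIter L.ctx L.sub L.start 1)

/-- The loop `L` is an `S`-loop: for all `n` and `i ≤ m`, the step
`tᵢ(C,μ)ⁿ →_{pⁿ qᵢ} tᵢ₊₁(C,μ)ⁿ` respects the strategy `S`, where `p` is the position of the hole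
of `C`. -/
def IsSLoop (S : Strategy) (L : LoopData) : Prop :=
  L.IsLoop ∧ ∀ n : ℕ, IsDerivation
    (fun t q s => S L.rules (ctxSubstIter L.ctx L.sub t n) (posPow L.ctx.holePos n ++ q)
      (ctxSubstIter L.ctx L.sub s n))
    L.start L.steps (ctxSubstIter L.ctx L.sub L.start 1)

end LoopData

/-- It is decidable whether a given `a` with `H a` satisfies `P`: one algorithm answers the
question correctly on all inputs `a` with `H a`. -/
def DecidableGiven {α : Type} [Primcodable α] (H P : α → Prop) : Prop :=
  ∃ d : α → Bool, Computable d ∧ ∀ a, H a → (d a = true ↔ P a)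

end LoopStrategies

/-! Rewriting is closed under contexts and substitutions, so only redexes at forbidden positions can
spoil an iteration of the loop. The subterm of `t(C,μ)ᵐ⁺ᵏ` at `pᵏ` is `t(C,μ)ᵐμᵏ`. Hence a violation
is a redex in some `uμᵏ`, left of, above or below a fixed position of `u`, where `u` is the source
`t` of a step or some `t(C,μ)ᵐ⁺¹`. The proof bounds computably an iteration in which a violation
occurs, if there is any; a finite search then decides. Let all variables be below `M` and all
left-hand sides have size at most `h`.

Identity problems `sμᵏ = s'μᵏ`: as `k` grows, either the kernel of `μᵏ` stays the same or `μᵏ⁺¹`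
factors through one variable fewer. So the kernel is constant from some `k ≤ M` on
(`subst_iter_eq_of_subst_iter_eq`).

Matching problems `uμᵏ = lσ`: every function symbol of `l` is exposed by `M` powers of `μ` or never,
and what remains are identity problems. So the exponent `M * h + M` suffices (`matches_subst_iter`).
Whether `xμᵏ` contains a redex for a variable `x` settles `M` powers later
(`exists_isRedexAt_iter`).

It remains to bound `m`. Left of the hole, `C[s]` does not depend on `s`, so `m = 0` suffices. Above
the hole, a pattern is matched against `D[t(C,μ)ᵐμ]μᴺ` with `D` a lower part of `C`. For large `m`
the innermost term lies too deep for the pattern to inspect and is too large to equal anything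
beside the hole path, so it can be exchanged for a small one (`exists_matches_ctxSubstIter`). Below
the position of the step only `u = t` occurs. -/

namespace LoopStrategies

open Term

/-! ### Sizes, variables and powers of substitutions -/

namespace Term

@[elab_as_elim]
theorem induction {P : Term → Prop} (var : ∀ x, P (var x))
    (app : ∀ f ts, (∀ t ∈ ts, P t) → P (app f ts)) : ∀ t, P t
  | .var x => var x
  | .app f ts => app f ts fun t _ => induction var app t

/-- The number of occurrences of function symbols. -/
def size : Term → ℕ
  | var _ => 0
  | app _ ts => (ts.map fun t => t.size).sum + 1

theorem hasVar_var {x y : ℕ} : HasVar x (var y) ↔ x = y := by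
  constructor
  · intro h
    cases h
    rfl
  · rintro rfl
    exact .var

theorem hasVar_app {x f : ℕ} {ts : List Term} :
    HasVar x (app f ts) ↔ ∃ t ∈ ts, HasVar x t := by
  constructor
  · intro h
    cases h with
    | app ht h => exact ⟨_, ht, h⟩
  · rintro ⟨t, ht, h⟩
    exact .app ht h

theorem subst_var (σ : ℕ → Term) (x : ℕ) : (var x).subst σ = σ x := by
  simp only [subst]

theorem subst_app (σ : ℕ → Term) (f : ℕ) (ts : List Term) :
    (app f ts).subst σ = app f (ts.map fun t => t.subst σ) := by
  simp only [subst]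

theorem subst_subst (σ τ : ℕ → Term) (t : Term) :
    (t.subst σ).subst τ = t.subst fun x => (σ x).subst τ := by
  induction t using induction with
  | var x => simp only [subst]
  | app f ts ih => simpa [subst_app] using ih

theorem subst_congr {σ τ : ℕ → Term} (t : Term) (h : ∀ x, HasVar x t → σ x = τ x) :
    t.subst σ = t.subst τ := by
  induction t using induction with
  | var x => exact by simpa only [subst] using h x .var
  | app f ts ih =>
    simp only [subst_app, app.injEq, true_and, List.map_inj_left]
    exact fun t ht => ih t ht fun x hx => h x (.app ht hx)

theorem subst_id (t : Term) : t.subst var = t := by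
  induction t using induction with
  | var x => simp only [subst]
  | app f ts ih =>
    simp only [subst_app, app.injEq, true_and]
    exact (List.map_congr_left ih).trans (List.map_id' ts)

theorem hasVar_subst {σ : ℕ → Term} {y : ℕ} {t : Term} :
    HasVar y (t.subst σ) ↔ ∃ x, HasVar x t ∧ HasVar y (σ x) := by
  induction t using induction with
  | var x => simp [subst, hasVar_var]
  | app f ts ih =>
    simp only [subst_app, hasVar_app, List.mem_map, exists_exists_and_eq_and]
    constructor
    · rintro ⟨t, ht, h⟩
      obtain ⟨x, hx, h⟩ := (ih t ht).1 h
      exact ⟨x, ⟨t, ht, hx⟩, h⟩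
    · rintro ⟨x, ⟨t, ht, hx⟩, h⟩
      exact ⟨t, ht, (ih t ht).2 ⟨x, hx, h⟩⟩

theorem size_var (x : ℕ) : (var x).size = 0 := by
  simp only [size]

theorem size_app (f : ℕ) (ts : List Term) :
    (app f ts).size = (ts.map fun t => t.size).sum + 1 := by
  simp only [size]

theorem size_lt_of_mem {f : ℕ} {ts : List Term} {t : Term} (h : t ∈ ts) :
    t.size < (app f ts).size := by
  rw [size_app]
  exact Nat.lt_succ_of_le (List.le_sum_of_mem (List.mem_map_of_mem h))

theorem size_le_subst (σ : ℕ → Term) (t : Term) : t.size ≤ (t.subst σ).size := by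
  induction t using induction with
  | var x => simp [size_var]
  | app f ts ih =>
    simp only [subst_app, size_app, List.map_map, add_le_add_iff_right]
    exact List.sum_le_sum ih

theorem size_subst_of_hasVar {σ : ℕ → Term} {x : ℕ} {t : Term} (h : HasVar x t) :
    (σ x).size ≤ (t.subst σ).size := by
  induction h with
  | var => rw [subst_var]
  | app ht _ ih =>
    rw [subst_app]
    exact ih.trans (size_lt_of_mem (List.mem_map_of_mem ht)).le

theorem size_subst_app_of_hasVar {σ : ℕ → Term} {x f : ℕ} {ts : List Term}
    (h : HasVar x (app f ts)) : (σ x).size < ((app f ts).subst σ).size := by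
  obtain ⟨t, ht, h⟩ := hasVar_app.1 h
  rw [subst_app]
  exact (size_subst_of_hasVar h).trans_lt (size_lt_of_mem (List.mem_map_of_mem ht))

/-- The powers of a substitution. -/
def iter (μ : ℕ → Term) : ℕ → ℕ → Term
  | 0, x => var x
  | k + 1, x => (μ x).subst (iter μ k)

theorem subst_iter_zero (μ : ℕ → Term) (t : Term) : t.subst (iter μ 0) = t := by
  conv_rhs => rw [← subst_id t]
  rfl

theorem subst_iter_succ (μ : ℕ → Term) (k : ℕ) (t : Term) :
    t.subst (iter μ (k + 1)) = (t.subst μ).subst (iter μ k) := by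
  rw [subst_subst]
  rfl

theorem subst_iter_add (μ : ℕ → Term) (k l : ℕ) (t : Term) :
    t.subst (iter μ (k + l)) = (t.subst (iter μ k)).subst (iter μ l) := by
  induction k generalizing t with
  | zero => rw [Nat.zero_add, subst_iter_zero]
  | succ k ih => rw [Nat.add_right_comm, subst_iter_succ, ih, ← subst_iter_succ]

theorem subst_iter_one (μ : ℕ → Term) (t : Term) : t.subst (iter μ 1) = t.subst μ := by
  rw [subst_iter_succ, subst_iter_zero]

theorem subst_iter_succ' (μ : ℕ → Term) (k : ℕ) (t : Term) :
    t.subst (iter μ (k + 1)) = (t.subst (iter μ k)).subst μ := by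
  rw [subst_iter_add, subst_iter_one]

/-- All variables of `t` are smaller than `M`. -/
def VarsLt (M : ℕ) (t : Term) : Prop :=
  ∀ x, HasVar x t → x < M

theorem varsLt_app {M f : ℕ} {ts : List Term} : VarsLt M (app f ts) ↔ ∀ t ∈ ts, VarsLt M t := by
  constructor
  · exact fun h t ht x hx => h x (.app ht hx)
  · intro h x hx
    obtain ⟨t, ht, hx⟩ := hasVar_app.1 hx
    exact h t ht x hx

theorem VarsLt.subst {M : ℕ} {σ : ℕ → Term} (hσ : ∀ x < M, VarsLt M (σ x)) {t : Term}
    (ht : VarsLt M t) : VarsLt M (t.subst σ) := by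
  intro y hy
  obtain ⟨x, hx, hy⟩ := hasVar_subst.1 hy
  exact hσ x (ht x hx) y hy

theorem VarsLt.subst_iter {M : ℕ} {μ : ℕ → Term} (hμ : ∀ x < M, VarsLt M (μ x)) {t : Term}
    (ht : VarsLt M t) (k : ℕ) : VarsLt M (t.subst (iter μ k)) := by
  induction k generalizing t with
  | zero => rwa [subst_iter_zero]
  | succ k ih =>
    rw [subst_iter_succ]
    exact ih (ht.subst hμ)

/-! ### Identity problems: the kernels of the powers of a substitution -/

/-- If a substitution identifies two distinct terms, then it factors through the elimination of
one of their variables. -/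
theorem exists_elimination {θ : ℕ → Term} (s t : Term) (hne : s ≠ t)
    (h : s.subst θ = t.subst θ) :
    ∃ x u, (HasVar x s ∨ HasVar x t) ∧ ¬ HasVar x u ∧
      (∀ y, HasVar y u → HasVar y s ∨ HasVar y t) ∧ θ x = u.subst θ := by
  induction s using induction generalizing t with
  | var x =>
    -- Occurs check: if `x` lay properly inside `t`, then `tθ` would be larger than `θ x`.
    by_cases hx : HasVar x t
    · cases t with
      | var y => exact absurd (by rw [hasVar_var.1 hx]) hne
      | app g ts =>
        have h1 := size_subst_app_of_hasVar (σ := θ) hx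
        rw [← h, subst_var] at h1
        exact absurd h1 (lt_irrefl _)
    · exact ⟨x, t, .inl .var, hx, fun y hy => .inr hy, by rw [← h, subst_var]⟩
  | app f ss ih =>
    cases t with
    | var x =>
      by_cases hx : HasVar x (app f ss)
      · have h1 := size_subst_app_of_hasVar (σ := θ) hx
        rw [h, subst_var] at h1
        exact absurd h1 (lt_irrefl _)
      · exact ⟨x, _, .inr .var, hx, fun y hy => .inl hy, by rw [h, subst_var]⟩
    | app g ts =>
      rw [subst_app, subst_app, app.injEq] at h
      obtain ⟨rfl, h⟩ := h
      have hlen : ss.length = ts.length := by simpa using congrArg List.length h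
      have hss : ss ≠ ts := fun h => hne (by rw [h])
      obtain ⟨i, hi, hne'⟩ : ∃ i, ∃ hi : i < ss.length, ss[i] ≠ ts[i] := by
        by_contra! hall
        exact hss (List.ext_getElem hlen fun i h1 _ => hall i h1)
      have hi' : i < ts.length := hlen ▸ hi
      have hsub : ss[i].subst θ = ts[i].subst θ := by
        have := congrArg (fun l => l[i]?) h
        simpa [hi, hi'] using this
      obtain ⟨x, u, hx, hxu, hu, hθ⟩ := ih _ (List.getElem_mem hi) _ hne' hsub
      have hs : ∀ y, HasVar y ss[i] ∨ HasVar y ts[i] →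
          HasVar y (app f ss) ∨ HasVar y (app f ts) := by
        rintro y (hy | hy)
        · exact .inl (.app (List.getElem_mem hi) hy)
        · exact .inr (.app (List.getElem_mem hi') hy)
      exact ⟨x, u, hs x hx, hxu, fun y hy => hs y (hu y hy), hθ⟩

/-- On the variables below `M`, the power `μ ^ k` factors through at most `d` variables. -/
def FactorsThrough (μ : ℕ → Term) (M k d : ℕ) : Prop :=
  ∃ S : Finset ℕ, S.card ≤ d ∧ ∃ σ δ : ℕ → Term,
    (∀ x < M, ∀ y, HasVar y (σ x) → y ∈ S) ∧ ∀ x < M, iter μ k x = (σ x).subst δ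

/-- On terms with variables below `M`, `μ ^ (k + 1)` identifies no more than `μ ^ k`. -/
def KernelStable (μ : ℕ → Term) (M k : ℕ) : Prop :=
  ∀ s t, VarsLt M s → VarsLt M t → s.subst (iter μ (k + 1)) = t.subst (iter μ (k + 1)) →
    s.subst (iter μ k) = t.subst (iter μ k)

/-- With `μᵏ = σδ` through the variables `S`, all depends on whether `δμ` is injective on terms over
`S`. If it is, `μᵏ⁺¹ = σ(δμ)` identifies only what `σ` already identifies. If not,
`exists_elimination` removes a variable from `S`. -/
theorem FactorsThrough.step {μ : ℕ → Term} {M k d : ℕ} (h : FactorsThrough μ M k d) :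
    KernelStable μ M k ∨ ∃ d', d = d' + 1 ∧ FactorsThrough μ M (k + 1) d' := by
  obtain ⟨S, hS, σ, δ, hσ, hk⟩ := h
  have hk1 : ∀ x < M, iter μ (k + 1) x = ((σ x).subst δ).subst μ := by
    intro x hx
    rw [← hk x hx, ← subst_var (iter μ (k + 1)) x, subst_iter_succ', subst_var]
  have hterm : ∀ t, VarsLt M t → t.subst (iter μ k) = (t.subst σ).subst δ := by
    intro t ht
    rw [subst_subst]
    exact subst_congr t fun x hx => hk x (ht x hx)
  by_cases hinj : ∀ s t : Term, (∀ y, HasVar y s → y ∈ S) → (∀ y, HasVar y t → y ∈ S) →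
      (s.subst δ).subst μ = (t.subst δ).subst μ → s = t
  · left
    intro s t hs ht hst
    have hvars : ∀ t, VarsLt M t → ∀ y, HasVar y (t.subst σ) → y ∈ S := by
      intro t ht y hy
      obtain ⟨x, hx, hy⟩ := hasVar_subst.1 hy
      exact hσ x (ht x hx) y hy
    rw [subst_iter_succ', subst_iter_succ', hterm s hs, hterm t ht] at hst
    rw [hterm s hs, hterm t ht, hinj _ _ (hvars s hs) (hvars t ht) hst]
  · right
    push Not at hinj
    obtain ⟨s, t, hs, ht, hst, hne⟩ := hinj
    rw [subst_subst, subst_subst] at hst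
    obtain ⟨x, u, hx, hxu, hu, hθ⟩ := exists_elimination s t hne hst
    have hxS : x ∈ S := hx.elim (hs x) (ht x)
    have huS : ∀ y, HasVar y u → y ∈ S.erase x := fun y hy =>
      Finset.mem_erase.2 ⟨fun h => hxu (h ▸ hy), (hu y hy).elim (hs y) (ht y)⟩
    have hcard := Finset.card_erase_add_one hxS
    -- `δμ` is unchanged when `x ↦ u` is applied first, so `σ` followed by this elimination uses
    -- only `S \ {x}`.
    refine ⟨d - 1, by omega, S.erase x, by omega,
      fun z => (σ z).subst fun y => if y = x then u else var y,
      fun y => (δ y).subst μ, fun z hz y hy => ?_, fun z hz => ?_⟩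
    · obtain ⟨w, hw, hy⟩ := hasVar_subst.1 hy
      split_ifs at hy with hwx
      · exact huS y hy
      · rw [hasVar_var.1 hy]
        exact Finset.mem_erase.2 ⟨hwx, hσ z hz w hw⟩
    · rw [hk1 z hz, subst_subst, subst_subst]
      refine subst_congr _ fun y _ => ?_
      split_ifs with hyx
      · rw [hyx, hθ]
      · rw [subst_var]

theorem FactorsThrough.exists_kernelStable {μ : ℕ → Term} {M d : ℕ} :
    ∀ k, FactorsThrough μ M k d → ∃ j ≤ k + d, KernelStable μ M j := by
  induction d with
  | zero =>
    intro k h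
    rcases h.step with h | ⟨d', h, _⟩
    · exact ⟨k, le_rfl, h⟩
    · omega
  | succ d ih =>
    intro k h
    rcases h.step with h | ⟨d', hd, h⟩
    · exact ⟨k, by omega, h⟩
    · obtain rfl : d = d' := by omega
      obtain ⟨j, hj, h⟩ := ih _ h
      exact ⟨j, by omega, h⟩

theorem subst_iter_eq_of_le {μ : ℕ → Term} {s t : Term} {k l : ℕ} (hkl : k ≤ l)
    (h : s.subst (iter μ k) = t.subst (iter μ k)) :
    s.subst (iter μ l) = t.subst (iter μ l) := by
  obtain ⟨m, rfl⟩ := Nat.exists_eq_add_of_le hkl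
  rw [subst_iter_add, subst_iter_add, h]

/-- An identity problem over `M` variables is solved by the power `μ ^ M` if it is solvable. -/
theorem subst_iter_eq_of_subst_iter_eq {μ : ℕ → Term} {M : ℕ} (hμ : ∀ x < M, VarsLt M (μ x))
    {s t : Term} (hs : VarsLt M s) (ht : VarsLt M t) {k : ℕ}
    (h : s.subst (iter μ k) = t.subst (iter μ k)) :
    s.subst (iter μ M) = t.subst (iter μ M) := by
  -- The identity factors through all `M` variables; at most `M` of them can be eliminated.
  have h0 : FactorsThrough μ M 0 M :=
    ⟨Finset.range M, by simp, var, var, fun x hx y hy => by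
      rw [hasVar_var.1 hy]; exact Finset.mem_range.2 hx, fun x _ => by rw [subst_var]; rfl⟩
  obtain ⟨j, hj, hst⟩ := h0.exists_kernelStable
  have key : ∀ i s t, VarsLt M s → VarsLt M t →
      s.subst (iter μ (i + j)) = t.subst (iter μ (i + j)) →
      s.subst (iter μ j) = t.subst (iter μ j) := by
    intro i
    induction i with
    | zero => exact fun s t _ _ h => by simpa using h
    | succ i ih =>
      intro s t hs ht h
      -- One `μ` is absorbed into the terms: the induction hypothesis for `sμ` and `tμ`, again over
      -- variables below `M`, gives equality under `μʲ⁺¹`, and stability at `j` removes the last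
      -- power.
      refine hst s t hs ht ?_
      rw [subst_iter_succ, subst_iter_succ]
      refine ih _ _ (hs.subst hμ) (ht.subst hμ) ?_
      rw [← subst_iter_succ, ← subst_iter_succ]
      rwa [Nat.add_right_comm] at h
  exact subst_iter_eq_of_le (by omega)
    (key k s t hs ht (subst_iter_eq_of_le (Nat.le_add_right k j) h))

end Term

/-! ### Matching problems -/

/-- An increasing chain of subsets of an `M`-element set cannot grow strictly `M + 1` times in a
row, and past `N` a single repetition makes it constant. -/
theorem _root_.Finset.subset_of_chain_stable {M N : ℕ} {A : ℕ → Finset ℕ}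
    (hA : ∀ k, A k ⊆ Finset.range M) (hmono : Monotone A)
    (hstep : ∀ k ≥ N, A (k + 1) = A k → A (k + 2) = A (k + 1)) (k : ℕ) : A k ⊆ A (N + M) := by
  obtain ⟨j, hj, hst⟩ : ∃ j ≤ M, A (N + j + 1) = A (N + j) := by
    by_contra! hne
    have hcard : ∀ j ≤ M + 1, j ≤ (A (N + j)).card := by
      intro j
      induction j with
      | zero => simp
      | succ j ih =>
        intro hj
        have := Finset.card_lt_card
          ((hmono (Nat.le_succ (N + j))).lt_of_ne (hne j (by omega)).symm)
        have := ih (by omega)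
        simp only [Nat.succ_eq_add_one, ← add_assoc] at *
        omega
    have h1 := hcard (M + 1) le_rfl
    have h2 := Finset.card_le_card (hA (N + (M + 1)))
    rw [Finset.card_range] at h2
    omega
  have hall : ∀ i, A (N + j + i + 1) = A (N + j + i) := by
    intro i
    induction i with
    | zero => exact hst
    | succ i ih => exact hstep (N + j + i) (by omega) ih
  have hall' : ∀ i, A (N + j + i) = A (N + j) := by
    intro i
    induction i with
    | zero => rfl
    | succ i ih => exact (hall i).trans ih
  calc A k ⊆ A (N + j + k) := hmono (by omega)
    _ = A (N + j) := hall' k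
    _ ⊆ A (N + M) := hmono (by omega)

namespace Term

/-- The variables below `M` that `μᵏ` turns into applications form an increasing chain, each set
being determined by the previous one: `x` enters if `μ x` is an application, or a variable that
entered before. -/
theorem exists_app_of_subst_iter {μ : ℕ → Term} {M : ℕ} (hμ : ∀ x < M, VarsLt M (μ x))
    {u : Term} (hu : VarsLt M u) {k f : ℕ} {ts : List Term}
    (h : u.subst (iter μ k) = app f ts) : ∃ g us, u.subst (iter μ M) = app g us := by
  cases u with
  | app g us => exact ⟨g, _, subst_app _ _ _⟩
  | var x =>
    classical
    let A : ℕ → Finset ℕ := fun k =>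
      (Finset.range M).filter fun x => ∃ g us, iter μ k x = app g us
    have hmem : ∀ k x, x ∈ A k ↔ x < M ∧ ∃ g us, iter μ k x = app g us := by simp [A]
    have hmono : Monotone A := monotone_nat_of_le_succ fun k x hx => by
      obtain ⟨hx, g, us, h⟩ := (hmem k x).1 hx
      refine (hmem _ x).2 ⟨hx, g, us.map fun t => t.subst μ, ?_⟩
      rw [← subst_var (iter μ (k + 1)) x, subst_iter_succ', subst_var, h, subst_app]
    have hrec : ∀ k x, x < M → (x ∈ A (k + 1) ↔
        (∃ g us, μ x = app g us) ∨ ∃ y, μ x = var y ∧ y ∈ A k) := by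
      intro k x hx
      have hlt := hμ x hx
      simp only [hmem, hx, true_and, iter]
      cases hm : μ x with
      | var y =>
        rw [hm] at hlt
        simp [subst_var, hlt y .var]
      | app g us => simp [subst_app]
    have hsub := Finset.subset_of_chain_stable (A := A) (N := 0) (fun k => Finset.filter_subset _ _)
      hmono (fun k _ hk => by
        ext x
        by_cases hx : x < M
        · rw [hrec (k + 1) x hx, hrec k x hx, hk]
        · simp [A, hx]) k
    rw [subst_var] at h ⊢
    have := hsub ((hmem k x).2 ⟨hu x .var, f, ts, h⟩)
    rw [Nat.zero_add] at this
    exact ((hmem M x).1 this).2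

/-- Descending along `l`, each function symbol uses up at most `M` powers of `μ`. With `M * h`
powers to spend, the last `K` are still unapplied when a variable of `l` is reached. -/
theorem exists_preimage_of_match {μ : ℕ → Term} {M : ℕ} (hμ : ∀ x < M, VarsLt M (μ x))
    {σ : ℕ → Term} {K : ℕ} : ∀ (h : ℕ) (l u : Term), l.size ≤ h → VarsLt M u →
      u.subst (iter μ (M * h + K)) = l.subst σ →
      ∀ x, HasVar x l → ∃ v, VarsLt M v ∧ v.subst (iter μ K) = σ x := by
  intro h
  induction h with
  | zero =>
    intro l u hl hu heq x hx
    cases l with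
    | var y =>
      rw [hasVar_var.1 hx]
      exact ⟨u, hu, by simpa [subst_var] using heq⟩
    | app f ls => rw [size_app] at hl; omega
  | succ h ih =>
    intro l u hl hu heq x hx
    cases l with
    | var y =>
      rw [hasVar_var.1 hx]
      exact ⟨_, hu.subst_iter hμ (M * (h + 1)), by rw [← subst_iter_add, heq, subst_var]⟩
    | app f ls =>
      rw [subst_app] at heq
      obtain ⟨g, us, hus⟩ := exists_app_of_subst_iter hμ hu heq
      have hlt := hu.subst_iter hμ M
      -- `M` powers are spent on exposing the root symbol of `u`; the arguments keep `M * h + K`.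
      rw [show M * (h + 1) + K = M + (M * h + K) by ring, subst_iter_add, hus, subst_app,
        app.injEq] at heq
      obtain ⟨l, hl', hx⟩ := hasVar_app.1 hx
      obtain ⟨v, hv, hvl⟩ : ∃ v ∈ us, v.subst (iter μ (M * h + K)) = l.subst σ := by
        have := List.mem_map_of_mem (f := fun t => t.subst σ) hl'
        rw [← heq.2] at this
        exact List.mem_map.1 this
      rw [hus] at hlt
      have := size_lt_of_mem (f := f) hl'
      exact ih l v (by omega) (varsLt_app.1 hlt v hv) hvl x hx

/-- The same descent, now with the preimages `τ x` at hand. Each occurrence of a variable of `l`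
yields an identity problem against the one term `τ x`, solvable by `μᴷ` and hence by `μᴹ`; this
covers nonlinear patterns. -/
theorem subst_iter_eq_of_match {μ : ℕ → Term} {M : ℕ} (hμ : ∀ x < M, VarsLt M (μ x))
    {σ τ : ℕ → Term} {K : ℕ} : ∀ (h : ℕ) (l u : Term), l.size ≤ h → VarsLt M u →
      u.subst (iter μ (M * h + K)) = l.subst σ →
      (∀ x, HasVar x l → VarsLt M (τ x) ∧ (τ x).subst (iter μ K) = σ x) →
      u.subst (iter μ (M * h + M)) = l.subst fun x => (τ x).subst (iter μ M) := by
  have hvar : ∀ (h y : ℕ) (u : Term), VarsLt M u →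
      u.subst (iter μ (M * h + K)) = σ y →
      (VarsLt M (τ y) ∧ (τ y).subst (iter μ K) = σ y) →
      u.subst (iter μ (M * h + M)) = (τ y).subst (iter μ M) := by
    intro h y u hu heq hτ
    rw [subst_iter_add]
    refine subst_iter_eq_of_subst_iter_eq hμ (hu.subst_iter hμ _) hτ.1 (k := K) ?_
    rw [← subst_iter_add, heq, hτ.2]
  intro h
  induction h with
  | zero =>
    intro l u hl hu heq hτ
    cases l with
    | var y => rw [subst_var] at *; exact hvar 0 y u hu heq (hτ y .var)
    | app f ls => rw [size_app] at hl; omega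
  | succ h ih =>
    intro l u hl hu heq hτ
    cases l with
    | var y => rw [subst_var] at *; exact hvar (h + 1) y u hu heq (hτ y .var)
    | app f ls =>
      rw [subst_app] at heq
      obtain ⟨g, us, hus⟩ := exists_app_of_subst_iter hμ hu heq
      have hlt := hu.subst_iter hμ M
      rw [show M * (h + 1) + K = M + (M * h + K) by ring, subst_iter_add, hus, subst_app,
        app.injEq] at heq
      rw [show M * (h + 1) + M = M + (M * h + M) by ring, subst_iter_add, hus, subst_app,
        subst_app, app.injEq]
      refine ⟨heq.1, ?_⟩
      rw [hus] at hlt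
      have hlen : us.length = ls.length := by simpa using congrArg List.length heq.2
      refine List.ext_getElem (by simpa using hlen) fun i h1 h2 => ?_
      simp only [List.length_map] at h1 h2
      have hi := congrArg (fun l => l[i]?) heq.2
      simp only [List.getElem?_map, List.getElem?_eq_getElem h1, List.getElem?_eq_getElem h2,
        Option.map_some, Option.some.injEq] at hi
      simp only [List.getElem_map]
      have := size_lt_of_mem (f := f) (List.getElem_mem h2)
      exact ih _ _ (by omega) (varsLt_app.1 hlt _ (List.getElem_mem h1)) hi
        fun x hx => hτ x (.app (List.getElem_mem h2) hx)

/-- The term `t` is an instance of `l`. -/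
def Matches (l t : Term) : Prop :=
  ∃ σ : ℕ → Term, t = l.subst σ

theorem Matches.subst {l t : Term} (h : Matches l t) (τ : ℕ → Term) : Matches l (t.subst τ) := by
  obtain ⟨σ, rfl⟩ := h
  exact ⟨_, subst_subst _ _ _⟩

theorem Matches.subst_iter_of_le {l t : Term} {μ : ℕ → Term} {j k : ℕ} (hjk : j ≤ k)
    (h : Matches l (t.subst (iter μ j))) : Matches l (t.subst (iter μ k)) := by
  obtain ⟨m, rfl⟩ := Nat.exists_eq_add_of_le hjk
  rw [subst_iter_add]
  exact h.subst _

/-- A solvable matching problem is solved by a power of `μ` that depends only on the number of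
variables and on the size of the pattern. -/
theorem matches_subst_iter {μ : ℕ → Term} {M : ℕ} (hμ : ∀ x < M, VarsLt M (μ x))
    {u l : Term} (hu : VarsLt M u) {h k : ℕ} (hl : l.size ≤ h)
    (hm : Matches l (u.subst (iter μ k))) : Matches l (u.subst (iter μ (M * h + M))) := by
  -- Matching survives further powers, so the exponent may be raised to `M * h + k`: `M * h` powers
  -- for the symbols of `l`, and `K = k` for the identity problems.
  obtain ⟨σ, hσ⟩ := hm.subst_iter_of_le (Nat.le_add_left k (M * h))
  have hpre := exists_preimage_of_match hμ h l u hl hu hσ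
  classical
  choose! τ hτ using hpre
  exact ⟨_, subst_iter_eq_of_match hμ h l u hl hu hσ hτ⟩

/-! ### Subterms of terms and of their instances -/

theorem subtermAt_nil (t : Term) : t.subtermAt [] = some t := by
  simp only [subtermAt]

theorem subtermAt_var_cons (x i : ℕ) (p : List ℕ) : (var x).subtermAt (i :: p) = none := by
  simp only [subtermAt]

theorem subtermAt_app_cons (f i : ℕ) (ts : List Term) (p : List ℕ) :
    (app f ts).subtermAt (i :: p) = ts[i]?.bind fun u => u.subtermAt p := by
  simp only [subtermAt]
  cases ts[i]? <;> rfl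

theorem subtermAt_append (t : Term) (p q : List ℕ) :
    t.subtermAt (p ++ q) = (t.subtermAt p).bind fun u => u.subtermAt q := by
  induction p generalizing t with
  | nil => simp [subtermAt_nil]
  | cons i p ih =>
    cases t with
    | var x => simp [subtermAt_var_cons]
    | app f ts =>
      simp only [List.cons_append, subtermAt_app_cons, Option.bind_assoc]
      congr 1
      exact funext ih

theorem subtermAt_subst {t v : Term} {p : List ℕ} (σ : ℕ → Term) (h : t.subtermAt p = some v) :
    (t.subst σ).subtermAt p = some (v.subst σ) := by
  induction p generalizing t with
  | nil =>
    rw [subtermAt_nil, Option.some.injEq] at h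
    rw [subtermAt_nil, h]
  | cons i p ih =>
    cases t with
    | var x => simp [subtermAt_var_cons] at h
    | app f ts =>
      rw [subtermAt_app_cons, Option.bind_eq_some_iff] at h
      obtain ⟨u, hu, h⟩ := h
      rw [subst_app, subtermAt_app_cons, List.getElem?_map, hu]
      exact ih h

theorem subtermAt_subst_cases {t w : Term} {r : List ℕ} {σ : ℕ → Term}
    (h : (t.subst σ).subtermAt r = some w) :
    (∃ v, t.subtermAt r = some v ∧ w = v.subst σ) ∨
      ∃ a b x, r = a ++ b ∧ t.subtermAt a = some (var x) ∧
        (σ x).subtermAt b = some w := by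
  induction r generalizing t with
  | nil =>
    rw [subtermAt_nil, Option.some.injEq] at h
    exact .inl ⟨t, subtermAt_nil t, h.symm⟩
  | cons i r ih =>
    cases t with
    | var x =>
      exact .inr ⟨[], i :: r, x, rfl, subtermAt_nil _, by rwa [subst_var] at h⟩
    | app f ts =>
      rw [subst_app, subtermAt_app_cons, List.getElem?_map, Option.bind_eq_some_iff] at h
      obtain ⟨_, hm, h⟩ := h
      obtain ⟨u, hu, rfl⟩ := Option.map_eq_some_iff.1 hm
      rcases ih h with ⟨v, hv, rfl⟩ | ⟨a, b, x, rfl, ha, hb⟩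
      · exact .inl ⟨v, by rw [subtermAt_app_cons, hu]; exact hv, rfl⟩
      · exact .inr ⟨i :: a, b, x, rfl, by rw [subtermAt_app_cons, hu]; exact ha, hb⟩

theorem HasVar.of_subtermAt {t v : Term} {p : List ℕ} {x : ℕ} (h : t.subtermAt p = some v)
    (hx : HasVar x v) : HasVar x t := by
  induction p generalizing t with
  | nil =>
    rw [subtermAt_nil, Option.some.injEq] at h
    rwa [h]
  | cons i p ih =>
    cases t with
    | var x => simp [subtermAt_var_cons] at h
    | app f ts =>
      rw [subtermAt_app_cons, Option.bind_eq_some_iff] at h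
      obtain ⟨u, hu, h⟩ := h
      exact .app (List.mem_of_getElem? hu) (ih h)

theorem HasVar.exists_subtermAt {t : Term} {x : ℕ} (h : HasVar x t) :
    ∃ p, t.subtermAt p = some (Term.var x) := by
  induction h with
  | var => exact ⟨[], subtermAt_nil _⟩
  | app ht _ ih =>
    obtain ⟨p, hp⟩ := ih
    obtain ⟨i, hi⟩ := List.mem_iff_getElem?.1 ht
    exact ⟨i :: p, by rw [subtermAt_app_cons, hi]; exact hp⟩

theorem size_le_of_subtermAt {t v : Term} {p : List ℕ} (h : t.subtermAt p = some v) :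
    v.size ≤ t.size := by
  induction p generalizing t with
  | nil =>
    rw [subtermAt_nil, Option.some.injEq] at h
    rw [h]
  | cons i p ih =>
    cases t with
    | var x => simp [subtermAt_var_cons] at h
    | app f ts =>
      rw [subtermAt_app_cons, Option.bind_eq_some_iff] at h
      obtain ⟨u, hu, h⟩ := h
      exact (ih h).trans (size_lt_of_mem (List.mem_of_getElem? hu)).le

theorem VarsLt.subtermAt {M : ℕ} {t v : Term} {p : List ℕ} (ht : VarsLt M t)
    (h : t.subtermAt p = some v) : VarsLt M v :=
  fun x hx => ht x (hx.of_subtermAt h)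

end Term

/-! ### Redexes in the powers of a substitution -/

/-- The term `t` is an instance of a left-hand side. -/
def IsRedex (R : TRS) (t : Term) : Prop :=
  ∃ ρ ∈ R, Matches ρ.1 t

theorem isRedexAt_iff {R : TRS} {t : Term} {p : List ℕ} :
    IsRedexAt R t p ↔ ∃ w, t.subtermAt p = some w ∧ IsRedex R w := by
  constructor
  · rintro ⟨ρ, hρ, σ, h⟩
    exact ⟨_, h, ρ, hρ, σ, rfl⟩
  · rintro ⟨w, h, ρ, hρ, σ, rfl⟩
    exact ⟨ρ, hρ, σ, h⟩

theorem IsRedex.subst {R : TRS} {t : Term} (h : IsRedex R t) (σ : ℕ → Term) :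
    IsRedex R (t.subst σ) := by
  obtain ⟨ρ, hρ, h⟩ := h
  exact ⟨ρ, hρ, h.subst σ⟩

theorem IsRedexAt.subst {R : TRS} {t : Term} {p : List ℕ} (h : IsRedexAt R t p) (σ : ℕ → Term) :
    IsRedexAt R (t.subst σ) p := by
  rw [isRedexAt_iff] at *
  obtain ⟨w, hw, h⟩ := h
  exact ⟨_, subtermAt_subst σ hw, h.subst σ⟩

section Stability

variable {R : TRS} {μ : ℕ → Term} {M h : ℕ}

theorem IsRedex.stable (hR : ∀ ρ ∈ R, ρ.1.size ≤ h) (hμ : ∀ x < M, VarsLt M (μ x)) {u : Term}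
    (hu : VarsLt M u) {k : ℕ} (hk : IsRedex R (u.subst (iter μ k))) :
    IsRedex R (u.subst (iter μ (M * h + M))) := by
  obtain ⟨ρ, hρ, hk⟩ := hk
  exact ⟨ρ, hρ, matches_subst_iter hμ hu (hR ρ hρ) hk⟩

theorem IsRedex.subst_iter_of_le {u : Term} {j k : ℕ} (hjk : j ≤ k)
    (hj : IsRedex R (u.subst (iter μ j))) : IsRedex R (u.subst (iter μ k)) := by
  obtain ⟨ρ, hρ, hj⟩ := hj
  exact ⟨ρ, hρ, hj.subst_iter_of_le hjk⟩

/-- A redex of `xμᵏ⁺¹ = (μ x)μᵏ` is either `vμᵏ` for a subterm `v` of `μ x`, or lies in `yμᵏ` for a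
variable `y` of `μ x`. From `k = M * h + M` on the first alternative no longer depends on `k`, so
the set of variables with a redex evolves by a fixed rule and is constant after `M` more steps. -/
theorem exists_isRedexAt_iter (hR : ∀ ρ ∈ R, ρ.1.size ≤ h) (hμ : ∀ x < M, VarsLt M (μ x))
    {x : ℕ} (hx : x < M) {k : ℕ} {p : List ℕ} (hk : IsRedexAt R (iter μ k x) p) :
    ∃ p, IsRedexAt R (iter μ (M * h + M + M) x) p := by
  classical
  let A : ℕ → Finset ℕ := fun k =>
    (Finset.range M).filter fun x => ∃ p, IsRedexAt R (iter μ k x) p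
  have hmem : ∀ k x, x ∈ A k ↔ x < M ∧ ∃ p, IsRedexAt R (iter μ k x) p := by simp [A]
  have hmono : Monotone A := monotone_nat_of_le_succ fun k x hx => by
    obtain ⟨hx, p, hp⟩ := (hmem k x).1 hx
    refine (hmem _ x).2 ⟨hx, p, ?_⟩
    rw [← subst_var (iter μ (k + 1)) x, subst_iter_succ', subst_var]
    exact hp.subst μ
  have hrec : ∀ k x, x < M → (x ∈ A (k + 1) ↔
      (∃ p v, (μ x).subtermAt p = some v ∧ IsRedex R (v.subst (iter μ k))) ∨
        ∃ y, HasVar y (μ x) ∧ y ∈ A k) := by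
    intro k x hx
    simp only [hmem, hx, true_and, iter, isRedexAt_iff]
    constructor
    · rintro ⟨p, w, hw, hred⟩
      rcases subtermAt_subst_cases hw with ⟨v, hv, rfl⟩ | ⟨a, b, y, rfl, ha, hb⟩
      · exact .inl ⟨p, v, hv, hred⟩
      · have hy : HasVar y (μ x) := HasVar.var.of_subtermAt ha
        exact .inr ⟨y, hy, hμ x hx y hy, b, w, hb, hred⟩
    · rintro (⟨p, v, hv, hred⟩ | ⟨y, hy, -, p, w, hw, hred⟩)
      · exact ⟨p, _, subtermAt_subst _ hv, hred⟩
      · obtain ⟨a, ha⟩ := hy.exists_subtermAt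
        refine ⟨a ++ p, w, ?_, hred⟩
        rw [subtermAt_append, subtermAt_subst _ ha, subst_var]
        exact hw
  have hsub := Finset.subset_of_chain_stable (A := A) (N := M * h + M)
    (fun k => Finset.filter_subset _ _) hmono (fun k hk hA => by
      ext x
      by_cases hx : x < M
      · rw [hrec (k + 1) x hx, hrec k x hx, hA]
        refine or_congr_left (exists_congr fun p => exists_congr fun v =>
          and_congr_right fun hv => ⟨fun hr => ?_, fun hr => ?_⟩)
        · exact (hr.stable hR hμ ((hμ x hx).subtermAt hv)).subst_iter_of_le hk
        · exact hr.subst_iter_of_le (Nat.le_succ k)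
      · simp [A, hx]) k
  exact ((hmem _ x).1 (hsub ((hmem k x).2 ⟨hx, p, hk⟩))).2

/-- The existence of a redex in a set of positions that is determined by the positions of `u` is
decided by a fixed power of `μ`. -/
theorem exists_isRedexAt_subst_iter (hR : ∀ ρ ∈ R, ρ.1.size ≤ h) (hμ : ∀ x < M, VarsLt M (μ x))
    {u : Term} (hu : VarsLt M u) {rel : List ℕ → Prop}
    (hrel : ∀ a b x, u.subtermAt a = some (var x) → rel (a ++ b) → ∀ c, rel (a ++ c))
    {k : ℕ} {r : List ℕ} (hr : rel r) (hk : IsRedexAt R (u.subst (iter μ k)) r) :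
    ∃ r, rel r ∧ IsRedexAt R (u.subst (iter μ (M * h + M + M))) r := by
  obtain ⟨w, hw, hred⟩ := isRedexAt_iff.1 hk
  rcases subtermAt_subst_cases hw with ⟨v, hv, rfl⟩ | ⟨a, b, x, rfl, ha, hb⟩
  · exact ⟨r, hr, isRedexAt_iff.2 ⟨_, subtermAt_subst _ hv,
      (hred.stable hR hμ (hu.subtermAt hv)).subst_iter_of_le (by omega)⟩⟩
  · have hx : x < M := hu x (HasVar.var.of_subtermAt ha)
    -- The redex inside the image of `x` may move to another position `c`; `hrel` keeps `a ++ c`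
    -- within the set.
    obtain ⟨c, hc⟩ := exists_isRedexAt_iter hR hμ hx (isRedexAt_iff.2 ⟨w, hb, hred⟩)
    obtain ⟨w', hw', hred'⟩ := isRedexAt_iff.1 hc
    refine ⟨a ++ c, hrel a b x ha hr c, isRedexAt_iff.2 ⟨w', ?_, hred'⟩⟩
    rw [subtermAt_append, subtermAt_subst _ ha, subst_var]
    exact hw'

end Stability

/-! ### Relative positions -/

theorem not_leftOf_nil_left (q : List ℕ) : ¬ LeftOf [] q := by
  rintro ⟨o, p', q', i, j, h, -⟩
  simp at h

theorem not_leftOf_nil_right (p : List ℕ) : ¬ LeftOf p [] := by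
  rintro ⟨o, p', q', i, j, -, h, -⟩
  simp at h

theorem leftOf_cons_cons {i j : ℕ} {p q : List ℕ} :
    LeftOf (i :: p) (j :: q) ↔ i < j ∨ i = j ∧ LeftOf p q := by
  constructor
  · rintro ⟨o, p', q', a, b, hp, hq, hab⟩
    cases o with
    | nil =>
      simp only [List.nil_append, List.cons.injEq] at hp hq
      exact .inl (by omega)
    | cons c o =>
      simp only [List.cons_append, List.cons.injEq] at hp hq
      exact .inr ⟨by omega, o, p', q', a, b, hp.2, hq.2, hab⟩
  · rintro (h | ⟨rfl, o, p', q', a, b, rfl, rfl, hab⟩)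
    · exact ⟨[], p, q, i, j, rfl, rfl, h⟩
    · exact ⟨i :: o, p', q', a, b, rfl, rfl, hab⟩

theorem leftOf_append_right {r p q : List ℕ} :
    LeftOf r (p ++ q) ↔ LeftOf r p ∨ ∃ r', r = p ++ r' ∧ LeftOf r' q := by
  induction p generalizing r with
  | nil => simp [not_leftOf_nil_right]
  | cons i p ih =>
    cases r with
    | nil => simp [not_leftOf_nil_left]
    | cons j r =>
      simp only [List.cons_append, leftOf_cons_cons, ih, List.cons.injEq, and_assoc]
      constructor
      · rintro (h | ⟨h, h' | ⟨r', h', h''⟩⟩)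
        · exact .inl (.inl h)
        · exact .inl (.inr ⟨h, h'⟩)
        · exact .inr ⟨r', h, h', h''⟩
      · rintro ((h | h) | ⟨r', h, h', h''⟩)
        · exact .inl h
        · exact .inr ⟨h.1, .inl h.2⟩
        · exact .inr ⟨h, .inr ⟨r', h', h''⟩⟩

theorem strictlyAbove_iff {p q : List ℕ} :
    StrictlyAbove p q ↔ ∃ r, r ≠ [] ∧ q = p ++ r := by
  constructor
  · rintro ⟨⟨r, rfl⟩, hne⟩
    exact ⟨r, by rintro rfl; simp at hne, rfl⟩
  · rintro ⟨r, hr, rfl⟩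
    exact ⟨⟨r, rfl⟩, by simpa using hr⟩

theorem strictlyAbove_append_right {r p q : List ℕ} :
    StrictlyAbove r (p ++ q) ↔ StrictlyAbove r p ∨ ∃ r', r = p ++ r' ∧ StrictlyAbove r' q := by
  simp only [strictlyAbove_iff]
  constructor
  · rintro ⟨s, hs, h⟩
    rcases List.append_eq_append_iff.1 h with ⟨a, rfl, rfl⟩ | ⟨a, rfl, rfl⟩
    · exact .inr ⟨a, rfl, s, hs, rfl⟩
    · by_cases ha : a = []
      · exact .inr ⟨[], by simp [ha], q, by simpa [ha] using hs, rfl⟩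
      · exact .inl ⟨a, ha, rfl⟩
  · rintro (⟨s, hs, rfl⟩ | ⟨r', rfl, s, hs, rfl⟩)
    · exact ⟨s ++ q, by simp [hs], by simp⟩
    · exact ⟨s, hs, by simp⟩

theorem strictlyAbove_append_left {r p q : List ℕ} :
    StrictlyAbove (p ++ q) r ↔ ∃ r', r = p ++ r' ∧ StrictlyAbove q r' := by
  simp only [strictlyAbove_iff]
  constructor
  · rintro ⟨s, hs, rfl⟩
    exact ⟨q ++ s, by simp, s, hs, rfl⟩
  · rintro ⟨_, rfl, s, hs, rfl⟩
    exact ⟨s, hs, by simp⟩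

theorem posPow_zero (p : List ℕ) : posPow p 0 = [] := by
  simp [posPow]

theorem posPow_succ (p : List ℕ) (n : ℕ) : posPow p (n + 1) = p ++ posPow p n := by
  simp [posPow, List.replicate_succ]

/-- Reduces positions left of or above `pⁿq` to positions left of or above one copy of `p`, or `q`
itself. -/
theorem exists_of_append_right_pow {rel : List ℕ → List ℕ → Prop}
    (hrel : ∀ r p q, rel r (p ++ q) ↔ rel r p ∨ ∃ r', r = p ++ r' ∧ rel r' q)
    (p q r : List ℕ) (n : ℕ) :
    rel r (posPow p n ++ q) ↔ (∃ k < n, ∃ r', r = posPow p k ++ r' ∧ rel r' p) ∨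
      ∃ r', r = posPow p n ++ r' ∧ rel r' q := by
  induction n generalizing r with
  | zero => simp [posPow_zero]
  | succ n ih =>
    rw [posPow_succ, List.append_assoc, hrel]
    constructor
    · rintro (h | ⟨r', rfl, h⟩)
      · exact .inl ⟨0, by omega, r, by simp [posPow_zero], h⟩
      · rcases (ih r').1 h with ⟨k, hk, s, rfl, hs⟩ | ⟨s, rfl, hs⟩
        · exact .inl ⟨k + 1, by omega, s, by simp [posPow_succ], hs⟩
        · exact .inr ⟨s, by simp, hs⟩
    · rintro (⟨k, hk, s, rfl, hs⟩ | ⟨s, rfl, hs⟩)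
      · cases k with
        | zero => exact .inl (by simpa [posPow_zero] using hs)
        | succ k =>
          exact .inr ⟨posPow p k ++ s, by simp [posPow_succ],
            (ih _).2 (.inl ⟨k, by omega, s, rfl, hs⟩)⟩
      · exact .inr ⟨posPow p n ++ s, by simp, (ih _).2 (.inr ⟨s, rfl, hs⟩)⟩

/-! ### Contexts -/

namespace Ctx

/-- The instance of a context under a substitution. -/
def subst (σ : ℕ → Term) (C : Ctx) : Ctx :=
  C.map fun c => (c.1, c.2.1.map fun t => t.subst σ, c.2.2.map fun t => t.subst σ)

theorem fill_cons (c : ℕ × List Term × List Term) (C : Ctx) (t : Term) :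
    fill (c :: C) t = app c.1 (c.2.1 ++ fill C t :: c.2.2) := by
  obtain ⟨f, l, r⟩ := c
  simp only [fill]

theorem fill_append (C D : Ctx) (t : Term) : fill (C ++ D) t = fill C (fill D t) := by
  induction C with
  | nil => simp [fill]
  | cons c C ih => rw [List.cons_append, fill_cons, fill_cons, ih]

theorem fill_subst (σ : ℕ → Term) (C : Ctx) (t : Term) :
    (C.fill t).subst σ = (C.subst σ).fill (t.subst σ) := by
  induction C with
  | nil => simp [fill, subst]
  | cons c C ih =>
    have h : Ctx.subst σ (c :: C) = (c.1, c.2.1.map fun t => t.subst σ,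
      c.2.2.map fun t => t.subst σ) :: Ctx.subst σ C := rfl
    rw [h, fill_cons, fill_cons, subst_app]
    simp [ih]

theorem holePos_subst (σ : ℕ → Term) (C : Ctx) : (C.subst σ).holePos = C.holePos := by
  simp [holePos, subst]

theorem length_subst (σ : ℕ → Term) (C : Ctx) : (C.subst σ).length = C.length := by
  simp [subst]

theorem subtermAt_fill_append (C : Ctx) (t : Term) (p : List ℕ) :
    (C.fill t).subtermAt (C.holePos ++ p) = t.subtermAt p := by
  induction C with
  | nil => simp [fill, holePos]
  | cons c C ih =>
    rw [fill_cons]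
    simp only [holePos, List.map_cons, List.cons_append, subtermAt_app_cons]
    simpa [holePos] using ih

theorem subtermAt_fill (C : Ctx) (t : Term) : (C.fill t).subtermAt C.holePos = some t := by
  have := subtermAt_fill_append C t []
  rwa [List.append_nil, subtermAt_nil] at this

/-- A position left of the hole leaves the hole path inside `C` and never meets the filling. -/
theorem subtermAt_fill_of_leftOf (C : Ctx) (s t : Term) {r : List ℕ} (h : LeftOf r C.holePos) :
    (C.fill s).subtermAt r = (C.fill t).subtermAt r := by
  induction C generalizing r with
  | nil => exact absurd h (not_leftOf_nil_right r)
  | cons c C ih =>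
    cases r with
    | nil => exact absurd h (not_leftOf_nil_left _)
    | cons i r =>
      simp only [holePos, List.map_cons] at h
      rw [fill_cons, fill_cons, subtermAt_app_cons, subtermAt_app_cons]
      rcases leftOf_cons_cons.1 h with h | ⟨rfl, h'⟩
      · rw [List.getElem?_append_left h, List.getElem?_append_left h]
      · simpa using ih h'

theorem exists_append_of_strictlyAbove (C : Ctx) {r : List ℕ}
    (h : StrictlyAbove r C.holePos) :
    ∃ C' D : Ctx, C = C' ++ D ∧ D ≠ [] ∧ r = C'.holePos := by
  obtain ⟨s, hs, h⟩ := strictlyAbove_iff.1 h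
  obtain ⟨C', D, rfl, rfl, rfl⟩ := List.map_eq_append_iff.1 h
  exact ⟨C', D, rfl, by rintro rfl; simp at hs, rfl⟩

theorem size_add_length_le_fill (C : Ctx) (t : Term) :
    t.size + C.length ≤ (C.fill t).size := by
  induction C with
  | nil => simp [fill]
  | cons c C ih =>
    have : (fill C t).size < (fill (c :: C) t).size := by
      rw [fill_cons]
      exact size_lt_of_mem (by simp)
    simp only [List.length_cons]
    omega

theorem size_lt_fill_of_mem {C : Ctx} {c : ℕ × List Term × List Term} (hc : c ∈ C) {s : Term}
    (hs : s ∈ c.2.1 ∨ s ∈ c.2.2) (t : Term) : s.size < (C.fill t).size := by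
  induction C with
  | nil => simp at hc
  | cons d C ih =>
    rw [fill_cons]
    rcases List.mem_cons.1 hc with rfl | hc
    · exact size_lt_of_mem (by rcases hs with hs | hs <;> simp [hs])
    · exact (ih hc).trans (size_lt_of_mem (by simp))

/-- If the hole of `G` is too deep for the pattern `l` and the term in the hole is too large to
occur beside it, then this term is irrelevant for matching. -/
theorem matches_fill_of_size_lt {z : Term} (z' : Term) (G : Ctx)
    (hG : ∀ c ∈ G, ∀ s, s ∈ c.2.1 ∨ s ∈ c.2.2 → s.size < z.size) (l : Term)
    (hl : l.size ≤ G.length) (σ : ℕ → Term) (h : G.fill z = l.subst σ) :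
    ∃ σ' : ℕ → Term, G.fill z' = l.subst σ' ∧ ∀ y, (σ y).size < z.size → σ' y = σ y := by
  induction G generalizing l with
  | nil =>
    cases l with
    | var x =>
      -- Here `σ x = z` is not smaller than `z`, so changing it respects the agreement clause, which
      -- the induction needs for the side arguments.
      refine ⟨Function.update σ x z', by simp [fill, subst_var], fun y hy => ?_⟩
      refine Function.update_of_ne (fun hyx => ?_) _ _
      rw [hyx, ← subst_var σ x, ← h] at hy
      exact lt_irrefl _ hy
    | app f ls => rw [size_app] at hl; simp at hl
  | cons c G ih =>
    cases l with
    | var x =>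
      refine ⟨Function.update σ x (fill (c :: G) z'), by simp [subst_var], fun y hy => ?_⟩
      refine Function.update_of_ne (fun hyx => ?_) _ _
      rw [hyx, ← subst_var σ x, ← h] at hy
      have := size_add_length_le_fill (c :: G) z
      omega
    | app f ls =>
      rw [fill_cons, subst_app, app.injEq] at h
      obtain ⟨hf, h⟩ := h
      obtain ⟨l₁, l₂, rfl, h₁, h₂⟩ := List.map_eq_append_iff.1 h.symm
      obtain ⟨b, r₁, rfl, hb, h₂⟩ := List.map_eq_cons_iff.1 h₂
      have hlt : b.size < (app f (l₁ ++ b :: r₁)).size := size_lt_of_mem (by simp)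
      simp only [List.length_cons] at hl
      obtain ⟨σ', hσ', hagree⟩ := ih (fun d hd => hG d (by simp [hd])) b (by omega) hb.symm
      -- A variable of a side argument has a value smaller than `z`, where `σ'` and `σ` agree.
      have hside : ∀ t : Term, t.subst σ ∈ c.2.1 ∨ t.subst σ ∈ c.2.2 → t.subst σ = t.subst σ' := by
        intro t ht
        refine subst_congr t fun y hy => (hagree y ?_).symm
        exact (size_subst_of_hasVar hy).trans_lt (hG c (by simp) _ ht)
      refine ⟨σ', ?_, hagree⟩
      rw [fill_cons, hσ', subst_app, hf, ← h₁, ← h₂, List.map_append, List.map_cons]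
      congr 2
      · refine List.map_congr_left fun t ht => hside t (.inl ?_)
        rw [← h₁]
        exact List.mem_map_of_mem ht
      · refine congrArg _ (List.map_congr_left fun t ht => hside t (.inr ?_))
        rw [← h₂]
        exact List.mem_map_of_mem ht

end Ctx

/-! ### The iterated terms `t(C,μ)ⁿ` -/

/-- Stripping one outer copy of `C` leaves one `μ` on the rest. -/
theorem subtermAt_ctxSubstIter (C : Ctx) (μ : FinSubst) (t : Term) (m k : ℕ) :
    (ctxSubstIter C μ t (m + k)).subtermAt (posPow C.holePos k) =
      some ((ctxSubstIter C μ t m).subst (iter μ.toFun k)) := by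
  induction k with
  | zero => rw [posPow_zero, subtermAt_nil, subst_iter_zero, Nat.add_zero]
  | succ k ih =>
    rw [posPow_succ, ← Nat.add_assoc, ctxSubstIter, Ctx.subtermAt_fill_append, subst_iter_succ']
    exact subtermAt_subst _ ih

theorem isRedexAt_ctxSubstIter {R : TRS} {C : Ctx} {μ : FinSubst} {t : Term} {m k : ℕ}
    {r : List ℕ} : IsRedexAt R (ctxSubstIter C μ t (m + k)) (posPow C.holePos k ++ r) ↔
      IsRedexAt R ((ctxSubstIter C μ t m).subst (iter μ.toFun k)) r := by
  simp only [isRedexAt_iff, subtermAt_append, subtermAt_ctxSubstIter, Option.bind_some]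

theorem isRedexAt_ctxSubstIter_zero {R : TRS} {C : Ctx} {μ : FinSubst} {t : Term} {k : ℕ}
    {r : List ℕ} : IsRedexAt R (ctxSubstIter C μ t k) (posPow C.holePos k ++ r) ↔
      IsRedexAt R (t.subst (iter μ.toFun k)) r := by
  have := isRedexAt_ctxSubstIter (R := R) (C := C) (μ := μ) (t := t) (m := 0) (k := k) (r := r)
  rwa [Nat.zero_add] at this

/-- The context `C[Cμ[⋯[Cμⁿ⁻¹]⋯]]`. -/
def ctxIter (C : Ctx) (μ : FinSubst) : ℕ → Ctx
  | 0 => []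
  | n + 1 => C ++ (ctxIter C μ n).subst μ.toFun

theorem ctxSubstIter_add (C : Ctx) (μ : FinSubst) (t : Term) (m n : ℕ) :
    ctxSubstIter C μ t (m + n) =
      (ctxIter C μ n).fill ((ctxSubstIter C μ t m).subst (iter μ.toFun n)) := by
  induction n with
  | zero => rw [subst_iter_zero, Nat.add_zero]; rfl
  | succ n ih =>
    rw [← Nat.add_assoc, ctxSubstIter, ih, ctxIter, Ctx.fill_append, Ctx.fill_subst,
      subst_iter_succ']

theorem length_ctxIter (C : Ctx) (μ : FinSubst) (n : ℕ) :
    (ctxIter C μ n).length = n * C.length := by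
  induction n with
  | zero => simp [ctxIter]
  | succ n ih =>
    rw [ctxIter, List.length_append, Ctx.length_subst, ih]
    ring

theorem le_size_ctxSubstIter {C : Ctx} (hC : 1 ≤ C.length) (μ : FinSubst) (t : Term) (n : ℕ) :
    n ≤ (ctxSubstIter C μ t n).size := by
  induction n with
  | zero => omega
  | succ n ih =>
    have h1 := size_le_subst μ.toFun (ctxSubstIter C μ t n)
    have h2 := Ctx.size_add_length_le_fill C ((ctxSubstIter C μ t n).subst μ.toFun)
    rw [ctxSubstIter]
    omega

/-- For a fixed power of `μ`, a solvable extended matching problem has a small solution. -/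
theorem exists_matches_ctxSubstIter {C C' D : Ctx} (hCD : C = C' ++ D) (hD : D ≠ [])
    (μ : FinSubst) (t : Term) (N : ℕ) {l : Term} {h : ℕ} (hl : l.size ≤ h) {m : ℕ}
    (hm : Matches l ((D.fill ((ctxSubstIter C μ t m).subst μ.toFun)).subst (iter μ.toFun N))) :
    ∃ m' ≤ h + (ctxSubstIter C μ t (h + 1 + N)).size,
      Matches l ((D.fill ((ctxSubstIter C μ t m').subst μ.toFun)).subst (iter μ.toFun N)) := by
  by_cases hle : m ≤ h + (ctxSubstIter C μ t (h + 1 + N)).size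
  · exact ⟨m, hle, hm⟩
  -- `G` comprises `D` and the outer `h` layers, deep enough to hide its hole from `l`; `z e` is
  -- what remains, of size at least `e`.
  obtain ⟨e, rfl⟩ : ∃ e, m = e + h := ⟨m - h, by omega⟩
  let G : Ctx := (D ++ (ctxIter C μ h).subst μ.toFun).subst (iter μ.toFun N)
  let z : ℕ → Term := fun e =>
    (((ctxSubstIter C μ t e).subst (iter μ.toFun h)).subst μ.toFun).subst (iter μ.toFun N)
  have hG : ∀ e, (D.fill ((ctxSubstIter C μ t (e + h)).subst μ.toFun)).subst (iter μ.toFun N) =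
      G.fill (z e) := by
    intro e
    rw [ctxSubstIter_add, Ctx.fill_subst μ.toFun, ← Ctx.fill_append, Ctx.fill_subst]
  have hlenC : 1 ≤ C.length := by
    have := List.length_pos_of_ne_nil hD
    rw [hCD, List.length_append]
    omega
  have hlenG : h ≤ G.length := by
    simp only [G, Ctx.length_subst, List.length_append, length_ctxIter]
    have := Nat.mul_le_mul_left h hlenC
    omega
  have hz : e ≤ (z e).size :=
    (le_size_ctxSubstIter hlenC μ t e).trans
      ((size_le_subst _ _).trans ((size_le_subst _ _).trans (size_le_subst _ _)))
  -- `G[z 0]` is a subterm of `t(C,μ)ʰ⁺¹μᴺ`, which is the subterm of `t(C,μ)ʰ⁺¹⁺ᴺ` at `pᴺ`. So every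
  -- side term of `G` is smaller than `e ≤ |z e|`.
  have hside : (G.fill (z 0)).size ≤ (ctxSubstIter C μ t (h + 1 + N)).size := by
    have h1 := size_le_of_subtermAt (subtermAt_ctxSubstIter C μ t (h + 1) N)
    refine le_trans ?_ h1
    rw [← hG 0, Nat.zero_add, ctxSubstIter]
    conv_rhs => rw [hCD, Ctx.fill_append, Ctx.fill_subst]
    refine le_trans (Nat.le_add_right _ _) (Ctx.size_add_length_le_fill _ _) |>.trans' ?_
    rw [← hCD]
  obtain ⟨σ, hσ⟩ := hm
  rw [hG] at hσ
  obtain ⟨σ', hσ', -⟩ := Ctx.matches_fill_of_size_lt (z 0) G (fun c hc s hs => by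
    have := Ctx.size_lt_fill_of_mem hc hs (z 0)
    omega) l (hl.trans hlenG) σ hσ
  -- Exchanging `z e` for `z 0` turns the solution for `e + h` into one for `h`.
  exact ⟨h, by omega, σ', by rw [← hσ', ← hG 0, Nat.zero_add]⟩

/-! ### Bounds on an iteration with a violation -/

section Bounds

variable {R : TRS} {C : Ctx} {μ : FinSubst} {t : Term} {M h : ℕ}

theorem varsLt_ctxSubstIter (hμ : ∀ x < M, VarsLt M (μ.toFun x))
    (hC : ∀ t, VarsLt M t → VarsLt M (C.fill t)) (ht : VarsLt M t) (n : ℕ) :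
    VarsLt M (ctxSubstIter C μ t n) := by
  induction n with
  | zero => exact ht
  | succ n ih => exact hC _ (ih.subst hμ)

/-- `P` is a position of `u` and cannot pass through the variable at `a`, so the two paths branch
inside `a`. -/
theorem leftOf_of_leftOf_append_var {u w : Term} {P a b : List ℕ} {x : ℕ}
    (hP : u.subtermAt P = some w) (ha : u.subtermAt a = some (var x))
    (h : LeftOf (a ++ b) P) (c : List ℕ) : LeftOf (a ++ c) P := by
  obtain ⟨o, p', q', i, j, h1, rfl, hij⟩ := h
  rcases List.append_eq_append_iff.1 h1 with ⟨d, rfl, h2⟩ | ⟨d, rfl, h2⟩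
  · cases d with
    | nil =>
      rw [List.append_nil, subtermAt_append, ha, Option.bind_some, subtermAt_var_cons] at hP
      cases hP
    | cons e d =>
      rw [List.append_assoc, subtermAt_append, ha, Option.bind_some, List.cons_append,
        subtermAt_var_cons] at hP
      cases hP
  · cases d with
    | nil =>
      rw [List.append_nil] at ha
      rw [subtermAt_append, ha, Option.bind_some, subtermAt_var_cons] at hP
      cases hP
    | cons e d =>
      simp only [List.cons_append, List.cons.injEq] at h2
      obtain ⟨rfl, rfl⟩ := h2
      exact ⟨o, d ++ c, q', i, j, by simp, rfl, hij⟩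

/-- `P` is a non-variable position of `u`, so it lies properly above the variable at `a`. -/
theorem strictlyAbove_append_var {u w : Term} {P a b : List ℕ} {x : ℕ}
    (hP : u.subtermAt P = some w) (hw : ∀ y, w ≠ var y) (ha : u.subtermAt a = some (var x))
    (h : StrictlyAbove P (a ++ b)) (c : List ℕ) : StrictlyAbove P (a ++ c) := by
  rw [strictlyAbove_iff] at *
  obtain ⟨r, hr, h⟩ := h
  rcases List.append_eq_append_iff.1 h with ⟨d, rfl, -⟩ | ⟨d, rfl, -⟩
  · cases d with
    | nil =>
      rw [List.append_nil, ha, Option.some.injEq] at hP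
      exact absurd hP.symm (hw x)
    | cons e d =>
      rw [subtermAt_append, ha, Option.bind_some, subtermAt_var_cons] at hP
      cases hP
  · cases d with
    | nil =>
      rw [List.append_nil, hP, Option.some.injEq] at ha
      exact absurd ha (hw x)
    | cons e d => exact ⟨e :: d ++ c, by simp, by simp⟩

/-- A redex left of a copy of `p` survives the exchange of `t(C,μ)ᵐ⁺¹` for `t(C,μ)¹`, since only the
part of `C` left of the hole matters; this accounts for the final `+ 1`. -/
theorem exists_leftOf_isRedexAt (hR : ∀ ρ ∈ R, ρ.1.size ≤ h)
    (hμ : ∀ x < M, VarsLt M (μ.toFun x)) (hC : ∀ t, VarsLt M t → VarsLt M (C.fill t))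
    (ht : VarsLt M t) {q : List ℕ} {w : Term} (hq : t.subtermAt q = some w) {n : ℕ}
    (hn : ∃ r, LeftOf r (posPow C.holePos n ++ q) ∧ IsRedexAt R (ctxSubstIter C μ t n) r) :
    ∃ n' ≤ M * h + M + M + 1, ∃ r, LeftOf r (posPow C.holePos n' ++ q) ∧
      IsRedexAt R (ctxSubstIter C μ t n') r := by
  have hpow := exists_of_append_right_pow (rel := LeftOf)
    fun _ _ _ => leftOf_append_right
  obtain ⟨r, hr, hred⟩ := hn
  rcases (hpow _ _ _ _).1 hr with ⟨k, hk, r', rfl, hr'⟩ | ⟨r', rfl, hr'⟩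
  · obtain ⟨m, rfl⟩ : ∃ m, n = m + 1 + k := ⟨n - 1 - k, by omega⟩
    rw [isRedexAt_ctxSubstIter] at hred
    obtain ⟨r'', hr'', hred⟩ := exists_isRedexAt_subst_iter hR hμ
      (varsLt_ctxSubstIter hμ hC ht (m + 1)) (rel := fun r => LeftOf r C.holePos)
      (fun a b x ha hab c => leftOf_of_leftOf_append_var (Ctx.subtermAt_fill _ _) ha hab c)
      hr' hred
    refine ⟨1 + (M * h + M + M), by omega, posPow C.holePos (M * h + M + M) ++ r'',
      (hpow _ _ _ _).2 (.inl ⟨_, by omega, r'', rfl, hr''⟩), ?_⟩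
    rw [isRedexAt_ctxSubstIter]
    rw [isRedexAt_iff] at hred ⊢
    obtain ⟨v, hv, hred⟩ := hred
    refine ⟨v, ?_, hred⟩
    rw [← hv, show ctxSubstIter C μ t 1 = C.fill (t.subst μ.toFun) from rfl, ctxSubstIter,
      Ctx.fill_subst, Ctx.fill_subst]
    exact Ctx.subtermAt_fill_of_leftOf _ _ _ (by rwa [Ctx.holePos_subst])
  · rw [isRedexAt_ctxSubstIter_zero] at hred
    obtain ⟨r'', hr'', hred⟩ := exists_isRedexAt_subst_iter hR hμ ht
      (rel := fun r => LeftOf r q)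
      (fun a b x ha hab c => leftOf_of_leftOf_append_var hq ha hab c) hr' hred
    exact ⟨M * h + M + M, by omega, _, (hpow _ _ _ _).2 (.inr ⟨r'', rfl, hr''⟩),
      isRedexAt_ctxSubstIter_zero.2 hred⟩

theorem exists_below_isRedexAt (hR : ∀ ρ ∈ R, ρ.1.size ≤ h)
    (hμ : ∀ x < M, VarsLt M (μ.toFun x)) (ht : VarsLt M t) {q : List ℕ} {w : Term}
    (hq : t.subtermAt q = some w) (hw : ∀ y, w ≠ var y) {n : ℕ}
    (hn : ∃ r, StrictlyAbove (posPow C.holePos n ++ q) r ∧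
      IsRedexAt R (ctxSubstIter C μ t n) r) :
    ∃ n' ≤ M * h + M + M, ∃ r, StrictlyAbove (posPow C.holePos n' ++ q) r ∧
      IsRedexAt R (ctxSubstIter C μ t n') r := by
  obtain ⟨r, hr, hred⟩ := hn
  obtain ⟨r', rfl, hr'⟩ := strictlyAbove_append_left.1 hr
  rw [isRedexAt_ctxSubstIter_zero] at hred
  obtain ⟨r'', hr'', hred⟩ := exists_isRedexAt_subst_iter hR hμ ht
    (rel := fun r => StrictlyAbove q r)
    (fun a b x ha hab c => strictlyAbove_append_var hq hw ha hab c) hr' hred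
  exact ⟨M * h + M + M, le_rfl, _, strictlyAbove_append_left.2 ⟨r'', rfl, hr''⟩,
    isRedexAt_ctxSubstIter_zero.2 hred⟩

/-- Positions above `p` or `q` are positions of `u` itself, so only matching problems arise. First
the power of `μ` is fixed to `M * h + M`, then `m` is bounded for this power. -/
theorem exists_above_isRedexAt (hR : ∀ ρ ∈ R, ρ.1.size ≤ h)
    (hμ : ∀ x < M, VarsLt M (μ.toFun x)) (hC : ∀ t, VarsLt M t → VarsLt M (C.fill t))
    (ht : VarsLt M t) {q : List ℕ} {w : Term} (hq : t.subtermAt q = some w) {n : ℕ}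
    (hn : ∃ r, StrictlyAbove r (posPow C.holePos n ++ q) ∧
      IsRedexAt R (ctxSubstIter C μ t n) r) :
    ∃ n' ≤ M * h + M + 1 + h + (ctxSubstIter C μ t (h + 1 + (M * h + M))).size,
      ∃ r, StrictlyAbove r (posPow C.holePos n' ++ q) ∧
        IsRedexAt R (ctxSubstIter C μ t n') r := by
  have hpow := exists_of_append_right_pow (rel := StrictlyAbove)
    fun _ _ _ => strictlyAbove_append_right
  obtain ⟨r, hr, hred⟩ := hn
  rcases (hpow _ _ _ _).1 hr with ⟨k, hk, r', rfl, hr'⟩ | ⟨r', rfl, hr'⟩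
  · obtain ⟨m, rfl⟩ : ∃ m, n = m + 1 + k := ⟨n - 1 - k, by omega⟩
    rw [isRedexAt_ctxSubstIter] at hred
    obtain ⟨C', D, hCD, hD, rfl⟩ := Ctx.exists_append_of_strictlyAbove C hr'
    have hsub : ∀ m, (ctxSubstIter C μ t (m + 1)).subtermAt C'.holePos =
        some (D.fill ((ctxSubstIter C μ t m).subst μ.toFun)) := by
      intro m
      rw [ctxSubstIter]
      conv_lhs => rw [hCD, Ctx.fill_append, Ctx.subtermAt_fill]
      rw [← hCD]
    obtain ⟨v, hv, hred⟩ := isRedexAt_iff.1 hred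
    rw [subtermAt_subst _ (hsub m), Option.some.injEq] at hv
    rw [← hv] at hred
    obtain ⟨ρ, hρ, hmatch⟩ := hred.stable hR hμ
      ((varsLt_ctxSubstIter hμ hC ht (m + 1)).subtermAt (hsub m))
    obtain ⟨m', hm', hmatch⟩ := exists_matches_ctxSubstIter hCD hD μ t _ (hR ρ hρ) hmatch
    refine ⟨m' + 1 + (M * h + M), by omega, posPow C.holePos (M * h + M) ++ C'.holePos,
      (hpow _ _ _ _).2 (.inl ⟨_, by omega, _, rfl, hr'⟩), isRedexAt_ctxSubstIter.2 ?_⟩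
    exact isRedexAt_iff.2 ⟨_, subtermAt_subst _ (hsub m'), ρ, hρ, hmatch⟩
  · rw [isRedexAt_ctxSubstIter_zero] at hred
    obtain ⟨s, -, rfl⟩ := strictlyAbove_iff.1 hr'
    rw [subtermAt_append, Option.bind_eq_some_iff] at hq
    obtain ⟨v, hv, -⟩ := hq
    obtain ⟨v', hv', hred⟩ := isRedexAt_iff.1 hred
    rw [subtermAt_subst _ hv, Option.some.injEq] at hv'
    rw [← hv'] at hred
    refine ⟨M * h + M, by omega, _, (hpow _ _ _ _).2 (.inr ⟨r', rfl, hr'⟩),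
      isRedexAt_ctxSubstIter_zero.2 (isRedexAt_iff.2 ⟨_, subtermAt_subst _ hv, ?_⟩)⟩
    exact hred.stable hR hμ (ht.subtermAt hv)

end Bounds

/-! ### Codes bound their components -/

theorem encode_le_of_mem {α : Type*} [Encodable α] {l : List α} {a : α} (h : a ∈ l) :
    Encodable.encode a ≤ Encodable.encode l := by
  induction l with
  | nil => simp at h
  | cons b l ih =>
    rw [Encodable.encode_list_cons]
    rcases List.mem_cons.1 h with rfl | h
    · exact (Nat.left_le_pair _ _).trans (Nat.le_succ _)
    · exact (ih h).trans ((Nat.right_le_pair _ _).trans (Nat.le_succ _))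

theorem encode_fst_le {α β : Type*} [Encodable α] [Encodable β] (a : α) (b : β) :
    Encodable.encode a ≤ Encodable.encode (a, b) := by
  rw [Encodable.encode_prod_val]
  exact Nat.left_le_pair _ _

theorem encode_snd_le {α β : Type*} [Encodable α] [Encodable β] (a : α) (b : β) :
    Encodable.encode b ≤ Encodable.encode (a, b) := by
  rw [Encodable.encode_prod_val]
  exact Nat.right_le_pair _ _

namespace Term

theorem encode_eq_code (t : Term) : Encodable.encode t = t.code := rfl

theorem code_var (x : ℕ) : (var x).code = 2 * x := by
  simp only [code]

theorem code_app (f : ℕ) (ts : List Term) :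
    (app f ts).code = 2 * Nat.pair f (Encodable.encode (ts.map fun t => t.code)) + 1 := by
  simp only [code]

theorem encode_map_code (ts : List Term) :
    Encodable.encode (ts.map fun t => t.code) = Encodable.encode ts := by
  induction ts with
  | nil => rfl
  | cons t ts ih =>
    rw [List.map_cons, Encodable.encode_list_cons, Encodable.encode_list_cons, ih,
      encode_eq_code, Encodable.encode_nat]

theorem code_app' (f : ℕ) (ts : List Term) :
    (app f ts).code = 2 * Nat.pair f (Encodable.encode ts) + 1 := by
  rw [code_app, encode_map_code]

theorem encode_args_lt_code (f : ℕ) (ts : List Term) :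
    Encodable.encode ts < (app f ts).code := by
  have := Nat.right_le_pair f (Encodable.encode ts)
  rw [code_app']
  omega

theorem code_lt_of_mem {f : ℕ} {ts : List Term} {t : Term} (h : t ∈ ts) :
    t.code < (app f ts).code :=
  (encode_le_of_mem h).trans_lt (encode_args_lt_code f ts)

theorem HasVar.le_code {x : ℕ} {t : Term} (h : HasVar x t) : x ≤ t.code := by
  induction h with
  | var => rw [code_var]; omega
  | app ht _ ih => exact ih.trans (code_lt_of_mem ht).le

theorem varsLt_of_code_lt {M : ℕ} {t : Term} (h : t.code < M) : VarsLt M t :=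
  fun _ hx => hx.le_code.trans_lt h

theorem size_le_code (t : Term) : t.size ≤ t.code := by
  induction t using induction with
  | var x => simp [size_var]
  | app f ts ih =>
    have h : (ts.map fun t => t.size).sum ≤ Encodable.encode ts := by
      clear f
      induction ts with
      | nil => simp
      | cons t ts ih' =>
        have h1 := ih t (by simp)
        have h2 := ih' fun s hs => ih s (by simp [hs])
        have h3 := Nat.add_le_pair (Encodable.encode t) (Encodable.encode ts)
        rw [List.map_cons, List.sum_cons, Encodable.encode_list_cons]
        rw [encode_eq_code] at *
        omega
    have := encode_args_lt_code f ts
    rw [size_app]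
    omega

end Term

/-! ### Derivations -/

/-- The source `tᵢ₊₁` of the `i`-th step of a derivation that starts in `t`. -/
def stepSource (t : Term) (steps : List (List ℕ × Term)) (i : ℕ) : Term :=
  ((t :: steps.map Prod.snd)[i]?).getD (var 0)

/-- The position of the `i`-th step of a derivation. -/
def stepPos (steps : List (List ℕ × Term)) (i : ℕ) : List ℕ :=
  ((steps.map Prod.fst)[i]?).getD []

theorem IsDerivation.exists_rel {rel : Term → List ℕ → Term → Prop} {t u : Term}
    {steps : List (List ℕ × Term)} (h : IsDerivation rel t steps u) {i : ℕ}
    (hi : i < steps.length) : ∃ s, rel (stepSource t steps i) (stepPos steps i) s := by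
  induction steps generalizing t i with
  | nil => simp at hi
  | cons a steps ih =>
    cases i with
    | zero => exact ⟨a.2, h.1⟩
    | succ i =>
      have := ih h.2 (i := i) (by simpa using hi)
      simpa [stepSource, stepPos] using this

/-- Along a given derivation, a strategy condition becomes one condition on the source and position
of each step. -/
theorem isDerivation_iff_forall {rel rel' : Term → List ℕ → Term → Prop}
    {P : Term → List ℕ → Prop} (hP : ∀ t q s, rel t q s → (rel' t q s ↔ P t q)) {t u : Term}
    {steps : List (List ℕ × Term)} (h : IsDerivation rel t steps u) :
    IsDerivation rel' t steps u ↔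
      ∀ i < steps.length, P (stepSource t steps i) (stepPos steps i) := by
  induction steps generalizing t with
  | nil => simpa [IsDerivation] using h
  | cons a steps ih =>
    rw [IsDerivation, hP _ _ _ h.1, ih h.2, List.length_cons, Nat.forall_lt_succ_left']
    simp [stepSource, stepPos]

theorem Rewrites.subst {R : TRS} {t s : Term} {p : List ℕ} (h : Rewrites R t p s)
    (τ : ℕ → Term) : Rewrites R (t.subst τ) p (s.subst τ) := by
  obtain ⟨ρ, hρ, σ, C, rfl, rfl, rfl⟩ := h
  exact ⟨ρ, hρ, fun x => (σ x).subst τ, C.subst τ, Ctx.holePos_subst _ _,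
    by rw [Ctx.fill_subst, subst_subst], by rw [Ctx.fill_subst, subst_subst]⟩

theorem Rewrites.fill {R : TRS} {t s : Term} {p : List ℕ} (h : Rewrites R t p s) (D : Ctx) :
    Rewrites R (D.fill t) (D.holePos ++ p) (D.fill s) := by
  obtain ⟨ρ, hρ, σ, C, rfl, rfl, rfl⟩ := h
  exact ⟨ρ, hρ, σ, D ++ C, by simp [Ctx.holePos], by rw [Ctx.fill_append],
    by rw [Ctx.fill_append]⟩

theorem Rewrites.ctxSubstIter {R : TRS} {t s : Term} {p : List ℕ} (h : Rewrites R t p s)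
    (C : Ctx) (μ : FinSubst) (n : ℕ) :
    Rewrites R (ctxSubstIter C μ t n) (posPow C.holePos n ++ p) (ctxSubstIter C μ s n) := by
  induction n with
  | zero => simpa [posPow_zero, LoopStrategies.ctxSubstIter] using h
  | succ n ih =>
    rw [posPow_succ, List.append_assoc]
    exact (ih.subst _).fill C

theorem Rewrites.subtermAt {R : TRS} {t s : Term} {p : List ℕ} (h : Rewrites R t p s)
    (hR : ∀ ρ ∈ R, ∀ x, ρ.1 ≠ var x) : ∃ w, t.subtermAt p = some w ∧ ∀ x, w ≠ var x := by
  obtain ⟨ρ, hρ, σ, C, rfl, rfl, rfl⟩ := h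
  refine ⟨_, Ctx.subtermAt_fill _ _, fun x hx => ?_⟩
  cases hl : ρ.1 with
  | var y => exact hR ρ hρ y hl
  | app f ls => rw [hl, subst_app] at hx; cases hx

/-! ### Bounding the power of a loop -/

namespace LoopData

/-- A strict bound on the numbers of variables and the sizes of the terms of a loop. -/
noncomputable def measure (L : LoopData) : ℕ :=
  Encodable.encode L + 1

/-- The source of the `i`-th step of a loop. -/
def source (L : LoopData) (i : ℕ) : Term :=
  stepSource L.start L.steps i

/-- A violation of a strategy by the `i`-th step of a loop occurs up to this power. -/
noncomputable def bound (L : LoopData) (i : ℕ) : ℕ :=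
  L.measure * L.measure + L.measure + L.measure + 1 + L.measure +
    (ctxSubstIter L.ctx L.sub (L.source i)
      (L.measure + 1 + (L.measure * L.measure + L.measure))).code

theorem encode_components_lt (L : LoopData) :
    Encodable.encode L.rules < L.measure ∧ Encodable.encode L.start < L.measure ∧
      Encodable.encode L.steps < L.measure ∧ Encodable.encode L.ctx < L.measure ∧
      Encodable.encode L.sub < L.measure := by
  have h : L.measure = Encodable.encode
    (L.sig, L.rules, L.start, L.steps, L.ctx, L.sub) + 1 := rfl
  have h1 := encode_snd_le L.sig (L.rules, L.start, L.steps, L.ctx, L.sub)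
  have h2 := encode_snd_le L.rules (L.start, L.steps, L.ctx, L.sub)
  have h3 := encode_snd_le L.start (L.steps, L.ctx, L.sub)
  have h4 := encode_snd_le L.steps (L.ctx, L.sub)
  have h5 := encode_fst_le L.rules (L.start, L.steps, L.ctx, L.sub)
  have h6 := encode_fst_le L.start (L.steps, L.ctx, L.sub)
  have h7 := encode_fst_le L.steps (L.ctx, L.sub)
  have h8 := encode_fst_le L.ctx L.sub
  have h9 := encode_snd_le L.ctx L.sub
  omega

theorem size_rule_le (L : LoopData) : ∀ ρ ∈ L.rules, ρ.1.size ≤ L.measure := by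
  intro ρ hρ
  have h1 := encode_le_of_mem hρ
  have h2 := encode_fst_le ρ.1 ρ.2
  have h3 := size_le_code ρ.1
  have h4 := L.encode_components_lt.1
  rw [encode_eq_code] at h2
  rw [Prod.mk.eta] at h2
  omega

theorem varsLt_sub (L : LoopData) : ∀ x < L.measure, VarsLt L.measure (L.sub.toFun x) := by
  intro x hx
  rw [FinSubst.toFun]
  cases h : List.lookup x L.sub with
  | none =>
    intro y hy
    rwa [hasVar_var.1 hy]
  | some t =>
    obtain ⟨l₁, l₂, hl, -⟩ := List.lookup_eq_some_iff.1 h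
    have h1 : (x, t) ∈ L.sub := by simp [hl]
    have h2 := encode_le_of_mem h1
    have h3 := encode_snd_le x t
    have h4 := L.encode_components_lt.2.2.2.2
    rw [encode_eq_code] at h3
    exact varsLt_of_code_lt (by rw [Option.getD_some]; omega)

theorem varsLt_fill (L : LoopData) (t : Term) (ht : VarsLt L.measure t) :
    VarsLt L.measure (L.ctx.fill t) := by
  have hside : ∀ c ∈ L.ctx, ∀ s, s ∈ c.2.1 ∨ s ∈ c.2.2 → VarsLt L.measure s := by
    rintro ⟨f, l, r⟩ hc s hs
    have h1 := encode_le_of_mem hc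
    have h2 := encode_snd_le f (l, r)
    have h3 := encode_fst_le l r
    have h4 := encode_snd_le l r
    have h5 := L.encode_components_lt.2.2.2.1
    refine varsLt_of_code_lt ?_
    rw [← encode_eq_code]
    rcases hs with hs | hs
    · have := encode_le_of_mem hs
      simp only at this
      omega
    · have := encode_le_of_mem hs
      simp only at this
      omega
  generalize L.ctx = C at hside
  induction C with
  | nil => exact ht
  | cons c C ih =>
    rw [Ctx.fill_cons, varsLt_app]
    intro s hs
    rw [List.mem_append, List.mem_cons] at hs
    rcases hs with hs | rfl | hs
    · exact hside c (by simp) s (.inl hs)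
    · exact ih fun d hd => hside d (by simp [hd])
    · exact hside c (by simp) s (.inr hs)

theorem varsLt_source (L : LoopData) (i : ℕ) : VarsLt L.measure (L.source i) := by
  have hL := L.encode_components_lt
  rw [source, stepSource]
  cases h : (L.start :: L.steps.map Prod.snd)[i]? with
  | none =>
    intro x hx
    rw [hasVar_var.1 hx]
    -- Out of range the source defaults to `var 0`, and the measure is a successor.
    exact Nat.succ_pos _
  | some t =>
    refine varsLt_of_code_lt ?_
    rw [Option.getD_some, ← encode_eq_code]
    rcases List.mem_cons.1 (List.mem_of_getElem? h) with rfl | h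
    · exact hL.2.1
    · obtain ⟨a, ha, rfl⟩ := List.mem_map.1 h
      have h1 := encode_le_of_mem ha
      have h2 := encode_snd_le a.1 a.2
      rw [Prod.mk.eta] at h2
      omega

/-- The `i`-th step of `L`, in the `n`-th iteration, has a redex at a position that is related by
`rel` to the position of the step. -/
def Violates (rel : List ℕ → List ℕ → Prop) (L : LoopData) (i n : ℕ) : Prop :=
  ∃ r, rel r (posPow L.ctx.holePos n ++ stepPos L.steps i) ∧
    IsRedexAt L.rules (ctxSubstIter L.ctx L.sub (L.source i) n) r

variable {L : LoopData}

theorem IsLoop.exists_subtermAt (hL : L.IsLoop) {i : ℕ} (hi : i < L.steps.length) :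
    ∃ w, (L.source i).subtermAt (stepPos L.steps i) = some w ∧ ∀ x, w ≠ var x := by
  obtain ⟨s, hs⟩ := hL.derivation.exists_rel hi
  exact hs.subtermAt fun ρ hρ => (hL.wf_rules ρ hρ).2.2.1

theorem IsLoop.violates_leftOf (hL : L.IsLoop) {i : ℕ} (hi : i < L.steps.length) {n : ℕ}
    (h : L.Violates LeftOf i n) : ∃ n' < L.bound i + 1, L.Violates LeftOf i n' := by
  obtain ⟨w, hw, -⟩ := hL.exists_subtermAt hi
  obtain ⟨n', hn', h⟩ := exists_leftOf_isRedexAt L.size_rule_le L.varsLt_sub L.varsLt_fill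
    (L.varsLt_source i) hw h
  exact ⟨n', by rw [bound]; omega, h⟩

theorem IsLoop.violates_below (hL : L.IsLoop) {i : ℕ} (hi : i < L.steps.length) {n : ℕ}
    (h : L.Violates (fun r p => StrictlyAbove p r) i n) :
    ∃ n' < L.bound i + 1, L.Violates (fun r p => StrictlyAbove p r) i n' := by
  obtain ⟨w, hw, hw'⟩ := hL.exists_subtermAt hi
  obtain ⟨n', hn', h⟩ := exists_below_isRedexAt L.size_rule_le L.varsLt_sub
    (L.varsLt_source i) hw hw' h
  exact ⟨n', by rw [bound]; omega, h⟩

theorem IsLoop.violates_above (hL : L.IsLoop) {i : ℕ} (hi : i < L.steps.length) {n : ℕ}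
    (h : L.Violates StrictlyAbove i n) : ∃ n' < L.bound i + 1, L.Violates StrictlyAbove i n' := by
  obtain ⟨w, hw, -⟩ := hL.exists_subtermAt hi
  obtain ⟨n', hn', h⟩ := exists_above_isRedexAt L.size_rule_le L.varsLt_sub L.varsLt_fill
    (L.varsLt_source i) hw h
  -- `bound` uses the code in place of the size: it is at least as large and evidently computable.
  have := size_le_code (ctxSubstIter L.ctx L.sub (L.source i)
      (L.measure + 1 + (L.measure * L.measure + L.measure)))
  exact ⟨n', by rw [bound]; omega, h⟩

/-- A strategy that is given by forbidding redexes at related positions is respected by a loop if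
it is respected by the iterations up to a bound. -/
theorem IsLoop.isSLoop_iff (hL : L.IsLoop) {S : Strategy} {rel rel' : List ℕ → List ℕ → Prop}
    (hS : ∀ R t p s, Rewrites R t p s → (S R t p s ↔
      (∀ r, rel r p → ¬ IsRedexAt R t r) ∧ ∀ r, rel' r p → ¬ IsRedexAt R t r))
    (hrel : ∀ i < L.steps.length, ∀ n, L.Violates rel i n →
      ∃ n' < L.bound i + 1, L.Violates rel i n')
    (hrel' : ∀ i < L.steps.length, ∀ n, L.Violates rel' i n →
      ∃ n' < L.bound i + 1, L.Violates rel' i n') :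
    L.IsSLoop S ↔ ∀ i < L.steps.length, ∀ n < L.bound i + 1,
      ¬ L.Violates rel i n ∧ ¬ L.Violates rel' i n := by
  have h : L.IsSLoop S ↔ ∀ n, ∀ i < L.steps.length,
      ¬ L.Violates rel i n ∧ ¬ L.Violates rel' i n := by
    rw [IsSLoop, and_iff_right hL]
    refine forall_congr' fun n => ?_
    -- The loop itself supplies the rewrite steps of every iteration; only the absence of redexes is
    -- left to check.
    refine (isDerivation_iff_forall (P := fun t q =>
      (∀ r, rel r (posPow L.ctx.holePos n ++ q) →
        ¬ IsRedexAt L.rules (ctxSubstIter L.ctx L.sub t n) r) ∧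
      ∀ r, rel' r (posPow L.ctx.holePos n ++ q) →
        ¬ IsRedexAt L.rules (ctxSubstIter L.ctx L.sub t n) r) (fun t q s hstep =>
      hS _ _ _ _ (hstep.ctxSubstIter L.ctx L.sub n)) hL.derivation).trans ?_
    simp only [Violates, not_exists, not_and, source]
  rw [h]
  constructor
  · exact fun h i hi n _ => h n i hi
  · intro h n i hi
    constructor
    · intro hv
      obtain ⟨n', hn', hv⟩ := hrel i hi n hv
      exact (h i hi n' hn').1 hv
    · intro hv
      obtain ⟨n', hn', hv⟩ := hrel' i hi n hv
      exact (h i hi n' hn').2 hv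

theorem IsLoop.isSLoop_leftmostInnermost_iff (hL : L.IsLoop) :
    L.IsSLoop leftmostInnermost ↔ ∀ i < L.steps.length, ∀ n < L.bound i + 1,
      ¬ L.Violates LeftOf i n ∧ ¬ L.Violates (fun r p => StrictlyAbove p r) i n :=
  hL.isSLoop_iff (fun _ _ _ _ h => by simp [leftmostInnermost, leftmost, innermost, h])
    (fun _ hi _ => hL.violates_leftOf hi) fun _ hi _ => hL.violates_below hi

theorem IsLoop.isSLoop_leftmostOutermost_iff (hL : L.IsLoop) :
    L.IsSLoop leftmostOutermost ↔ ∀ i < L.steps.length, ∀ n < L.bound i + 1,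
      ¬ L.Violates LeftOf i n ∧ ¬ L.Violates StrictlyAbove i n :=
  hL.isSLoop_iff (fun _ _ _ _ h => by simp [leftmostOutermost, leftmost, outermost, h])
    (fun _ hi _ => hL.violates_leftOf hi) fun _ hi _ => hL.violates_above hi

end LoopData

open Primrec

/-! ### Primitive recursiveness of the operations on terms -/

theorem primrecRel_exists_lt {β : Type*} [Primcodable β] {P : ℕ → β → Prop} (hP : PrimrecRel P) :
    PrimrecRel fun n b => ∃ k < n, P k b :=
  (hP.exists_mem_list.comp (list_range.comp fst) snd).of_eq (by simp)

theorem primrecRel_forall_lt {β : Type*} [Primcodable β] {P : ℕ → β → Prop} (hP : PrimrecRel P) :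
    PrimrecRel fun n b => ∀ k < n, P k b :=
  (hP.forall_mem_list.comp (list_range.comp fst) snd).of_eq (by simp)

theorem primrec_two_mul_add (c : ℕ) : Primrec fun n : ℕ => 2 * n + c :=
  nat_add.comp (nat_mul.comp (const 2) .id) (const c)

theorem primrec_app : Primrec₂ Term.app := by
  refine Primrec₂.encode_iff.1 (((primrec_two_mul_add 1).comp
    (Primrec₂.natPair.comp fst (Primrec.encode.comp snd))).of_eq fun a => ?_)
  exact (code_app' a.1 a.2).symm

theorem primrec_var : Primrec Term.var :=
  Primrec.encode_iff.1 (((primrec_two_mul_add 0).of_eq fun n => (code_var n).symm))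

/-- The arguments of a term. -/
def Term.args : Term → List Term
  | .var _ => []
  | .app _ ts => ts

theorem primrec_args : Primrec Term.args := by
  have h : Primrec fun t : Term => if Encodable.encode t % 2 = 1 then
      (Encodable.decode (α := List Term) (Encodable.encode t / 2).unpair.2).getD [] else [] :=
    ite (Primrec.eq.comp (nat_mod.comp Primrec.encode (const 2)) (const 1))
      (option_getD.comp (Primrec.decode.comp (snd.comp (unpair.comp
        (nat_div.comp Primrec.encode (const 2))))) (const [])) (const [])
  refine h.of_eq fun t => ?_
  rw [encode_eq_code]
  cases t with
  | var x => rw [code_var, if_neg (by omega)]; rfl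
  | app f ts =>
    rw [code_app', if_pos (by omega),
      show (2 * Nat.pair f (Encodable.encode ts) + 1) / 2 = Nat.pair f (Encodable.encode ts) by
        omega,
      Nat.unpair_pair, Encodable.encodek, Option.getD_some]
    rfl

theorem primrec_lookup : Primrec₂ fun (x : ℕ) (μ : FinSubst) => List.lookup x μ := by
  have h : Primrec fun a : ℕ × FinSubst => a.2.foldr (fun (p : ℕ × Term) (o : Option Term) =>
      if a.1 = p.1 then some p.2 else o) none :=
    list_foldr (h := fun a (p : (ℕ × Term) × Option Term) =>
      if a.1 = p.1.1 then some p.1.2 else p.2) snd (const none)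
      (ite (Primrec.eq.comp (fst.comp fst) (fst.comp (fst.comp snd)))
        (option_some.comp (snd.comp (fst.comp snd))) (snd.comp snd)).to₂
  refine h.of_eq fun a => ?_
  induction a.2 with
  | nil => rfl
  | cons p μ ih =>
    rw [List.foldr_cons, ih]
    obtain ⟨y, t⟩ := p
    simp only [List.lookup_cons]
    by_cases hp : a.1 = y
    · simp [hp]
    · rw [if_neg hp, beq_false_of_ne hp]

theorem primrec_toFun : Primrec₂ FinSubst.toFun :=
  (option_getD.comp (primrec_lookup.comp snd fst) (primrec_var.comp snd)).to₂

theorem primrec_subst : Primrec₂ fun (μ : FinSubst) (t : Term) => t.subst μ.toFun := by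
  have h : Primrec₂ fun (μ : FinSubst) (n : ℕ) => (Denumerable.ofNat Term n).subst μ.toFun := by
    -- Course-of-values recursion on codes: `l` lists the results for all smaller codes, so its
    -- length is the current code. An odd code is an application, whose argument codes are smaller
    -- and index into `l`.
    let g : FinSubst → List Term → Term := fun μ l =>
      if l.length % 2 = 1 then
        Term.app (l.length / 2).unpair.1 (((Encodable.decode (α := List ℕ)
          (l.length / 2).unpair.2).getD []).map fun m => l.getD m (Term.var 0))
      else μ.toFun (l.length / 2)
    have hlen : Primrec fun p : FinSubst × List Term => p.2.length := list_length.comp snd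
    have hup : Primrec fun p : FinSubst × List Term => (p.2.length / 2).unpair :=
      unpair.comp (nat_div.comp hlen (const 2))
    have hg : Primrec₂ g :=
      (ite (Primrec.eq.comp (nat_mod.comp hlen (const 2)) (const 1))
        (primrec_app.comp (fst.comp hup)
          (list_map (option_getD.comp (Primrec.decode.comp (snd.comp hup)) (const []))
            ((list_getD (Term.var 0)).comp (snd.comp fst) snd).to₂))
        (primrec_toFun.comp fst (nat_div.comp hlen (const 2)))).to₂
    refine nat_strong_rec (g := fun μ l => some (g μ l)) _ (Primrec₂.option_some_iff.2 hg) ?_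
    intro μ n
    obtain ⟨t, rfl⟩ := code_surjective n
    have hof : ∀ t : Term, Denumerable.ofNat Term t.code = t := Denumerable.ofNat_encode
    simp only [g, List.length_map, List.length_range, hof, Option.some.injEq]
    cases t with
    | var x =>
      rw [code_var, if_neg (by omega), subst_var]
      congr 1
      omega
    | app f ts =>
      have hdiv : (app f ts).code / 2 =
          Nat.pair f (Encodable.encode (ts.map fun t => t.code)) := by
        rw [code_app]
        omega
      rw [if_pos (by rw [code_app]; omega), hdiv, Nat.unpair_pair, Encodable.encodek,
        Option.getD_some, subst_app, List.map_map]
      refine congrArg _ (List.map_congr_left fun t ht => ?_)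
      have hlt := code_lt_of_mem (f := f) ht
      simp [List.getD, hlt, hof]
  exact (h.comp fst (Primrec.encode.comp snd)).to₂.of_eq fun μ t => by
    rw [Denumerable.ofNat_encode]

theorem primrec_fill : Primrec₂ Ctx.fill := by
  have h : Primrec fun a : Ctx × Term => a.1.foldr
      (fun (c : ℕ × List Term × List Term) (u : Term) =>
        Term.app c.1 (c.2.1 ++ u :: c.2.2)) a.2 :=
    list_foldr (h := fun _ (p : (ℕ × List Term × List Term) × Term) =>
      Term.app p.1.1 (p.1.2.1 ++ p.2 :: p.1.2.2)) fst snd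
      (primrec_app.comp (fst.comp (fst.comp snd)) (list_append.comp
        (fst.comp (snd.comp (fst.comp snd))) (list_cons.comp (snd.comp snd)
          (snd.comp (snd.comp (fst.comp snd)))))).to₂
  refine h.of_eq fun a => ?_
  obtain ⟨C, t⟩ := a
  induction C with
  | nil => rfl
  | cons c C ih => rw [Ctx.fill_cons, ← ih]; rfl

theorem primrec_ctxSubstIter :
    Primrec fun a : (Ctx × FinSubst) × Term × ℕ => ctxSubstIter a.1.1 a.1.2 a.2.1 a.2.2 := by
  have h := nat_rec' (f := fun a : (Ctx × FinSubst) × Term × ℕ => a.2.2) (g := fun a => a.2.1)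
    (h := fun a p => a.1.1.fill (p.2.subst a.1.2.toFun)) (snd.comp snd) (fst.comp snd)
    (primrec_fill.comp (fst.comp (fst.comp fst))
      (primrec_subst.comp (snd.comp (fst.comp fst)) (snd.comp snd))).to₂
  refine h.of_eq fun a => ?_
  induction a.2.2 with
  | zero => rfl
  | succ n ih => rw [ctxSubstIter, ← ih]

theorem primrec_holePos : Primrec Ctx.holePos :=
  list_map .id (list_length.comp (fst.comp (snd.comp snd))).to₂

theorem primrec_posPow : Primrec₂ posPow := by
  have h := nat_rec' (f := fun a : List ℕ × ℕ => a.2) (g := fun _ => ([] : List ℕ))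
    (h := fun a p => a.1 ++ p.2) snd (const []) (list_append.comp (fst.comp fst) (snd.comp snd)).to₂
  refine h.of_eq fun a => ?_
  induction a.2 with
  | zero => exact (posPow_zero _).symm
  | succ n ih => rw [posPow_succ, ← ih]

theorem primrec_subtermAt : Primrec₂ Term.subtermAt := by
  have h : Primrec fun a : Term × List ℕ => a.2.foldl
      (fun (o : Option Term) (i : ℕ) => o.bind fun t => t.args[i]?) (some a.1) :=
    list_foldl (h := fun _ (p : Option Term × ℕ) => p.1.bind fun t => t.args[p.2]?) snd
      (option_some.comp fst)
      (option_bind (fst.comp snd)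
        (list_getElem?.comp (primrec_args.comp snd) (snd.comp (snd.comp fst))).to₂).to₂
  refine h.of_eq fun a => ?_
  obtain ⟨t, p⟩ := a
  have hnone : ∀ p : List ℕ, p.foldl
      (fun (o : Option Term) (i : ℕ) => o.bind fun t => t.args[i]?) none = none := by
    intro p
    induction p with
    | nil => rfl
    | cons i p ih => exact ih
  simp only
  induction p generalizing t with
  | nil => exact (subtermAt_nil t).symm
  | cons i p ih =>
    rw [List.foldl_cons, Option.bind_some]
    cases t with
    | var x => rw [subtermAt_var_cons]; exact hnone p
    | app f ts =>
      rw [subtermAt_app_cons, Term.args]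
      cases ts[i]? with
      | none => exact hnone p
      | some u => exact ih u

theorem primrec_replicate {α : Type*} [Primcodable α] :
    Primrec₂ fun (n : ℕ) (a : α) => List.replicate n a :=
  (list_map (f := fun p : ℕ × α => List.range p.1) (g := fun p _ => p.2) (list_range.comp fst)
    (snd.comp fst).to₂).of_eq fun p => by simp

theorem primrec_stepSource : Primrec fun a : Term × List (List ℕ × Term) × ℕ =>
    stepSource a.1 a.2.1 a.2.2 :=
  option_getD.comp (list_getElem?.comp (list_cons.comp fst (list_map (fst.comp snd)
    (snd.comp snd).to₂)) (snd.comp snd)) (const _)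

theorem primrec_stepPos : Primrec₂ stepPos :=
  (option_getD.comp (list_getElem?.comp (list_map fst (fst.comp snd).to₂) snd) (const _)).to₂

/-! ### Relative positions -/

theorem primrecRel_leftOf : PrimrecRel LeftOf := by
  -- `k` is the length of the common prefix `o`.
  let P : ℕ → List ℕ × List ℕ → Prop := fun k a =>
    k < a.2.length ∧ a.1.take k = a.2.take k ∧ a.1.getD k 0 < a.2.getD k 0
  have hP : PrimrecRel P :=
    (nat_lt.comp fst (list_length.comp (snd.comp snd))).and
      ((Primrec.eq.comp (list_take.comp fst (fst.comp snd)) (list_take.comp fst (snd.comp snd))).and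
        (nat_lt.comp ((list_getD 0).comp (fst.comp snd) fst)
          ((list_getD 0).comp (snd.comp snd) fst)))
  refine ((primrecRel_exists_lt hP).comp (list_length.comp fst) .id).of_eq fun a => ?_
  obtain ⟨p, q⟩ := a
  constructor
  · rintro ⟨k, hk, hkq, h1, h2⟩
    simp only [id_eq] at hk hkq h1 h2
    refine ⟨p.take k, p.drop (k + 1), q.drop (k + 1), p[k], q[k], ?_, ?_, ?_⟩
    · rw [← List.drop_eq_getElem_cons hk, List.take_append_drop]
    · rw [h1, ← List.drop_eq_getElem_cons hkq, List.take_append_drop]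
    · simpa [List.getD, hk, hkq] using h2
  · rintro ⟨o, p', q', i, j, rfl, rfl, hij⟩
    exact ⟨o.length, by simp, by simp, by simp, by simpa using hij⟩

theorem primrecRel_strictlyAbove : PrimrecRel StrictlyAbove := by
  refine ((Primrec.eq.comp (list_take.comp (list_length.comp fst) snd) fst).and
    (Primrec.eq.comp fst snd).not).of_eq fun a => ?_
  rw [StrictlyAbove, List.prefix_iff_eq_take, eq_comm]

/-! ### Deciding the existence of redexes -/

theorem pair_le_pair {a a' b b' : ℕ} (ha : a ≤ a') (hb : b ≤ b') :
    Nat.pair a b ≤ Nat.pair a' b' := by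
  have h1 : Nat.pair a b ≤ Nat.pair a' b := by
    rcases ha.eq_or_lt with rfl | ha
    · exact le_rfl
    · exact (Nat.pair_lt_pair_left b ha).le
  have h2 : Nat.pair a' b ≤ Nat.pair a' b' := by
    rcases hb.eq_or_lt with rfl | hb
    · exact le_rfl
    · exact (Nat.pair_lt_pair_right a' hb).le
  exact h1.trans h2

/-- Yields search bounds for positions and substitutions from bounds on their length and entries. -/
theorem encode_le_encode_replicate {α : Type*} [Encodable α] {l : List α} {m : ℕ} {a : α}
    (hl : l.length ≤ m) (h : ∀ b ∈ l, Encodable.encode b ≤ Encodable.encode a) :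
    Encodable.encode l ≤ Encodable.encode (List.replicate m a) := by
  induction l generalizing m with
  | nil => simp
  | cons b l ih =>
    cases m with
    | zero => simp at hl
    | succ m =>
      rw [List.replicate_succ, Encodable.encode_list_cons, Encodable.encode_list_cons]
      refine Nat.succ_le_succ (pair_le_pair (h b (by simp)) (ih ?_ fun c hc => h c (by simp [hc])))
      simpa using hl

theorem code_le_of_subtermAt {t v : Term} {p : List ℕ} (h : t.subtermAt p = some v) :
    v.code ≤ t.code := by
  induction p generalizing t with
  | nil =>
    rw [subtermAt_nil, Option.some.injEq] at h
    rw [h]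
  | cons i p ih =>
    cases t with
    | var x => simp [subtermAt_var_cons] at h
    | app f ts =>
      rw [subtermAt_app_cons, Option.bind_eq_some_iff] at h
      obtain ⟨u, hu, h⟩ := h
      exact (ih h).trans (code_lt_of_mem (List.mem_of_getElem? hu)).le

theorem code_subst_of_hasVar {σ : ℕ → Term} {x : ℕ} {t : Term} (h : HasVar x t) :
    (σ x).code ≤ (t.subst σ).code := by
  obtain ⟨p, hp⟩ := h.exists_subtermAt
  have := subtermAt_subst σ hp
  rw [subst_var] at this
  exact code_le_of_subtermAt this

theorem encode_position_le {t v : Term} {p : List ℕ} (h : t.subtermAt p = some v) :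
    p.length ≤ t.code ∧ ∀ i ∈ p, i ≤ t.code := by
  induction p generalizing t with
  | nil => simp
  | cons i p ih =>
    cases t with
    | var x => simp [subtermAt_var_cons] at h
    | app f ts =>
      rw [subtermAt_app_cons, Option.bind_eq_some_iff] at h
      obtain ⟨u, hu, h⟩ := h
      have hlt := code_lt_of_mem (f := f) (List.mem_of_getElem? hu)
      obtain ⟨h1, h2⟩ := ih h
      refine ⟨by simp only [List.length_cons]; omega, ?_⟩
      intro j hj
      rcases List.mem_cons.1 hj with rfl | hj
      · have h3 : j < ts.length := (List.getElem?_eq_some_iff.1 hu).1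
        have h4 := encode_args_lt_code f ts
        have h5 := Encodable.length_le_encode ts
        omega
      · exact (h2 j hj).trans hlt.le

/-- The list of bindings with code `e`. -/
noncomputable def decodeSubst (e : ℕ) : FinSubst :=
  (Encodable.decode (α := FinSubst) e).getD []

/-- Only variables up to `l.code` matter, and their values are subterms of `t`, hence of no larger
code. -/
theorem exists_finSubst_of_matches {l t : Term} (h : Matches l t) :
    ∃ μ : FinSubst, t = l.subst μ.toFun ∧
      Encodable.encode μ ≤ Encodable.encode (List.replicate (l.code + 1) (l.code, t)) := by
  classical
  obtain ⟨σ, rfl⟩ := h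
  -- Variables that do not occur in `l` are bound to `t` itself, which keeps the codes bounded.
  let μ : FinSubst := (List.range (l.code + 1)).map fun x =>
    (x, if HasVar x l then σ x else l.subst σ)
  refine ⟨μ, subst_congr l fun x hx => ?_, encode_le_encode_replicate (by simp [μ]) ?_⟩
  · have hlook : ∀ (L : List ℕ), x ∈ L → List.lookup x
        (L.map fun x => (x, if HasVar x l then σ x else l.subst σ)) = some (σ x) := by
      intro L
      induction L with
      | nil => simp
      | cons y L ih =>
        intro hxL
        rw [List.map_cons, List.lookup_cons]
        by_cases hxy : x = y
        · subst hxy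
          simp [hx]
        · rw [beq_false_of_ne hxy]
          exact ih ((List.mem_cons.1 hxL).resolve_left hxy)
    rw [FinSubst.toFun, hlook _ (List.mem_range.2 (Nat.lt_succ_of_le hx.le_code)),
      Option.getD_some]
  · intro b hb
    obtain ⟨x, hx, rfl⟩ := List.mem_map.1 hb
    rw [Encodable.encode_prod_val, Encodable.encode_prod_val]
    refine pair_le_pair (Nat.lt_succ_iff.1 (List.mem_range.1 hx)) ?_
    simp only [encode_eq_code]
    split_ifs with hxl
    · exact code_subst_of_hasVar hxl
    · exact le_rfl

theorem primrecRel_matches : PrimrecRel Matches := by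
  let P : ℕ → Term × Term → Prop := fun e a => a.2 = a.1.subst (decodeSubst e).toFun
  have hP : PrimrecRel P := Primrec.eq.comp (snd.comp snd)
    (primrec_subst.comp (option_getD.comp (Primrec.decode.comp fst) (const [])) (fst.comp snd))
  have hbound : Primrec fun a : Term × Term =>
      Encodable.encode (List.replicate (a.1.code + 1) (a.1.code, a.2)) + 1 :=
    Primrec.succ.comp (Primrec.encode.comp (primrec_replicate.comp
      (Primrec.succ.comp (Primrec.encode.comp fst)) ((Primrec.encode.comp fst).pair snd)))
  refine ((primrecRel_exists_lt hP).comp hbound .id).of_eq fun a => ?_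
  constructor
  · rintro ⟨e, -, he⟩
    exact ⟨_, he⟩
  · intro h
    obtain ⟨μ, hμ, hle⟩ := exists_finSubst_of_matches h
    refine ⟨_, Nat.lt_succ_of_le hle, ?_⟩
    simp only [P, decodeSubst, Encodable.encodek, Option.getD_some]
    exact hμ

theorem primrecPred_isRedexAt :
    PrimrecPred fun a : TRS × Term × List ℕ => IsRedexAt a.1 a.2.1 a.2.2 := by
  have hP : PrimrecRel fun (ρ : Term × Term) (w : Term) => Matches ρ.1 w :=
    primrecRel_matches.comp (fst.comp fst) snd
  have hsub : Primrec fun a : TRS × Term × List ℕ => a.2.1.subtermAt a.2.2 :=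
    primrec_subtermAt.comp (fst.comp snd) (snd.comp snd)
  -- The default `var 0` is harmless: the second conjunct demands that the position exists.
  refine ((hP.exists_mem_list.comp fst (option_getD.comp hsub (const (Term.var 0)))).and
    (Primrec.eq.comp (option_isSome.comp hsub) (const true))).of_eq fun a => ?_
  rw [isRedexAt_iff]
  cases a.2.1.subtermAt a.2.2 <;> simp [IsRedex]

/-- A redex position is a position of the term, so its length and entries are bounded by the code of
the term and a bounded search finds it. -/
theorem primrecPred_exists_isRedexAt {rel : List ℕ → List ℕ → Prop} (hrel : PrimrecRel rel) :
    PrimrecPred fun a : TRS × Term × List ℕ => ∃ r, rel r a.2.2 ∧ IsRedexAt a.1 a.2.1 r := by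
  let pos : ℕ → List ℕ := fun e => (Encodable.decode (α := List ℕ) e).getD []
  have hpos : Primrec pos := option_getD.comp Primrec.decode (const [])
  let P : ℕ → TRS × Term × List ℕ → Prop := fun e a =>
    rel (pos e) a.2.2 ∧ IsRedexAt a.1 a.2.1 (pos e)
  have hP : PrimrecRel P :=
    (hrel.comp (hpos.comp fst) (snd.comp (snd.comp snd))).and
      (primrecPred_isRedexAt.comp ((fst.comp snd).pair
        ((fst.comp (snd.comp snd)).pair (hpos.comp fst))))
  have hcode : Primrec fun a : TRS × Term × List ℕ => a.2.1.code :=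
    Primrec.encode.comp (fst.comp snd)
  have hbound : Primrec fun a : TRS × Term × List ℕ =>
      Encodable.encode (List.replicate a.2.1.code a.2.1.code) + 1 :=
    Primrec.succ.comp (Primrec.encode.comp (primrec_replicate.comp hcode hcode))
  refine ((primrecRel_exists_lt hP).comp hbound .id).of_eq fun a => ?_
  constructor
  · rintro ⟨e, -, he⟩
    exact ⟨_, he⟩
  · rintro ⟨r, hr, hred⟩
    obtain ⟨w, hw, -⟩ := isRedexAt_iff.1 hred
    obtain ⟨h1, h2⟩ := encode_position_le hw
    refine ⟨Encodable.encode r, Nat.lt_succ_of_le (encode_le_encode_replicate h1 h2), ?_⟩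
    simp only [P, pos, Encodable.encodek, Option.getD_some]
    exact ⟨hr, hred⟩

/-! ### Deciding loops -/

namespace LoopData

theorem primrec_equivProd : Primrec equivProd :=
  Primrec.of_equiv

theorem primrec_rules : Primrec LoopData.rules :=
  fst.comp (snd.comp primrec_equivProd)

theorem primrec_start : Primrec LoopData.start :=
  fst.comp (snd.comp (snd.comp primrec_equivProd))

theorem primrec_steps : Primrec LoopData.steps :=
  fst.comp (snd.comp (snd.comp (snd.comp primrec_equivProd)))

theorem primrec_ctx : Primrec LoopData.ctx :=
  fst.comp (snd.comp (snd.comp (snd.comp (snd.comp primrec_equivProd))))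

theorem primrec_sub : Primrec LoopData.sub :=
  snd.comp (snd.comp (snd.comp (snd.comp (snd.comp primrec_equivProd))))

theorem primrec_measure : Primrec measure :=
  Primrec.succ.comp Primrec.encode

theorem primrec_source : Primrec₂ source :=
  (primrec_stepSource.comp ((primrec_start.comp fst).pair
    ((primrec_steps.comp fst).pair snd))).to₂

theorem primrec_iterSource : Primrec fun a : (LoopData × ℕ) × ℕ =>
    ctxSubstIter a.1.1.ctx a.1.1.sub (a.1.1.source a.1.2) a.2 :=
  primrec_ctxSubstIter.comp (((primrec_ctx.comp (fst.comp fst)).pair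
    (primrec_sub.comp (fst.comp fst))).pair
      ((primrec_source.comp (fst.comp fst) (snd.comp fst)).pair snd))

theorem primrec_bound : Primrec₂ bound := by
  have hM : Primrec fun a : LoopData × ℕ => a.1.measure := primrec_measure.comp fst
  have hMM : Primrec fun a : LoopData × ℕ => a.1.measure * a.1.measure + a.1.measure :=
    nat_add.comp (nat_mul.comp hM hM) hM
  exact (nat_add.comp (nat_add.comp (Primrec.succ.comp (nat_add.comp hMM hM)) hM)
    (Primrec.encode.comp (primrec_iterSource.comp (Primrec.id.pair
      (nat_add.comp (Primrec.succ.comp hM) hMM))))).to₂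

theorem primrecPred_violates {rel : List ℕ → List ℕ → Prop} (hrel : PrimrecRel rel) :
    PrimrecPred fun a : (LoopData × ℕ) × ℕ => a.1.1.Violates rel a.1.2 a.2 :=
  (primrecPred_exists_isRedexAt hrel).comp ((primrec_rules.comp (fst.comp fst)).pair
    (primrec_iterSource.pair (list_append.comp
      (primrec_posPow.comp (primrec_holePos.comp (primrec_ctx.comp (fst.comp fst))) snd)
      (primrec_stepPos.comp (primrec_steps.comp (fst.comp fst)) (snd.comp fst)))))

theorem primrecPred_respects {rel rel' : List ℕ → List ℕ → Prop} (hrel : PrimrecRel rel)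
    (hrel' : PrimrecRel rel') : PrimrecPred fun L : LoopData =>
      ∀ i < L.steps.length, ∀ n < L.bound i + 1,
        ¬ L.Violates rel i n ∧ ¬ L.Violates rel' i n := by
  have h1 : PrimrecRel fun (n : ℕ) (a : LoopData × ℕ) =>
      ¬ a.1.Violates rel a.2 n ∧ ¬ a.1.Violates rel' a.2 n :=
    (((primrecPred_violates hrel).comp (snd.pair fst)).not).and
      (((primrecPred_violates hrel').comp (snd.pair fst)).not)
  have h2 : PrimrecRel fun (i : ℕ) (L : LoopData) => ∀ n < L.bound i + 1,
      ¬ L.Violates rel i n ∧ ¬ L.Violates rel' i n :=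
    (primrecRel_forall_lt h1).comp (Primrec.succ.comp (primrec_bound.comp snd fst)) (snd.pair fst)
  exact (primrecRel_forall_lt h2).comp (list_length.comp primrec_steps) .id

end LoopData

/-- The algorithm evaluates `Q` on every input; `H` is needed only for its answer to be correct. -/
theorem decidableGiven_of_primrecPred {α : Type} [Primcodable α] {H P Q : α → Prop}
    (hQ : PrimrecPred Q) (h : ∀ a, H a → (P a ↔ Q a)) : DecidableGiven H P := by
  classical
  exact ⟨fun a => decide (Q a), hQ.decide.to_comp, fun a ha => by
    rw [decide_eq_true_iff, h a ha]⟩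

end LoopStrategies

theorem mainTheorem2 :
    LoopStrategies.DecidableGiven LoopStrategies.LoopData.IsLoop
        (LoopStrategies.LoopData.IsSLoop LoopStrategies.leftmostInnermost) ∧
      LoopStrategies.DecidableGiven LoopStrategies.LoopData.IsLoop
        (LoopStrategies.LoopData.IsSLoop LoopStrategies.leftmostOutermost) :=
  ⟨LoopStrategies.decidableGiven_of_primrecPred
      (LoopStrategies.LoopData.primrecPred_respects LoopStrategies.primrecRel_leftOf
        LoopStrategies.primrecRel_strictlyAbove.swap)
      fun _ hL => hL.isSLoop_leftmostInnermost_iff,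
    LoopStrategies.decidableGiven_of_primrecPred
      (LoopStrategies.LoopData.primrecPred_respects LoopStrategies.primrecRel_leftOf
        LoopStrategies.primrecRel_strictlyAbove)
      fun _ hL => hL.isSLoop_leftmostOutermost_iff⟩
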